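/- Let $(\mathfrak X,\mathscr X)$ be a measurable space with a $\sigma$-finite measure $\mu$, and let $f_0,f_1:\mathfrak X\to[0,\infty)$ be probability densities with respect to $\mu$ with $\mu\{f_0\ne f_1\}>0$. Observations arrive in groups. The group sizes $\nu_1,\nu_2,\dots$ are independent and identically distributed with values in $\mathscr G\subset\{0,1,2,\dots\}$ and $P(\nu_k=m)=p(m)$, where $P(\nu_k\ge 1)>0$; given the group sizes, all observations are independent with density $f_i$ under the hypothesis $H_i$, $i=0,1$. A group of size $m\in\mathscr G$ costs $c(m)>0$, and $\sum_{m\in\mathscr G}p(m)c(m)<\infty$. For $k\ge1$ and $n=(n_1,\dots,n_k)\in\mathscr G^k$ put $p(n)=\prod_{i}p(n_i)$, $c(n)=\sum_i c(n_i)$, $\mathfrak X^n=\mathfrak X^{n_1}\times\dots\times\mathfrak X^{n_k}$, $f_i^{(n)}(x)=\prod_{r=1}^k\prod_{j=1}^{n_r}f_i(x_{rj})$ for $x\in\mathfrak X^n$, let $E_i$ be the expectation under $f_i^{(n)}$ with respect to the product measure $\mu^n$, and let $z_n=f_1^{(n)}/f_0^{(n)}$, with $z_n=\infty$ where $f_0^{(n)}=0<f_1^{(n)}$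 and $z_n=0$ where $f_0^{(n)}=f_1^{(n)}=0$. A stopping rule $\psi$ and a decision rule $\phi$ are families of measurable functions $\psi_n,\phi_n:\mathfrak X^n\to[0,1]$, $n\in\mathscr G^k$, $k\ge1$ (the conditional probabilities to stop, respectively to reject $H_0$, given the group sizes and the data). A test is a pair $(\psi,\phi)$. Let $t_n^\psi=\prod_{j=1}^{k-1}\bigl(1-\psi_{(n_1,\dots,n_j)}\bigr)$ and $s_n^\psi=t_n^\psi\psi_n$ for $n\in\mathscr G^k$, and $$\alpha(\psi,\phi)=\sum_{k\ge1}\sum_{n\in\mathscr G^k}p(n)E_0 s_n^\psi\phi_n,\quad \beta(\psi,\phi)=\sum_{k\ge1}\sum_{n\in\mathscr G^k}p(n)E_1 s_n^\psi(1-\phi_n),\quad K_i(\psi)=\sum_{k\ge1}\sum_{n\in\mathscr G^k}p(n)c(n)E_i s_n^\psi .$$ Let $\mathscr S_i$ be the set of the tests $(\psi,\phi)$ with $\sum_{k\ge1}\sum_{n\in\mathscr G^k}p(n)E_i s_n^\psi=1$ (the test stops with probability one under $H_i$). Theorem. Let $0<A<B<\infty$. Let $\psi$ be any stopping rule with $$I_{\{z_n\in(A,B)\}}\le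 1-\psi_n\le I_{\{z_n\in[A,B]\}}$$ and let $\phi$ be the decision rule $\phi_n=I_{\{z_n\ge B\}}$, for all $n\in\mathscr G^k$ and $k\ge1$. Then $(\psi,\phi)\in\mathscr S_0\cap\mathscr S_1$, and for every test $(\psi',\phi')\in\mathscr S_0\cap\mathscr S_1$ such that $$\alpha(\psi',\phi')\le\alpha(\psi,\phi)\quad\text{and}\quad\beta(\psi',\phi')\le\beta(\psi,\phi)$$ one has $$K_0(\psi)\le K_0(\psi')\quad\text{and}\quad K_1(\psi)\le K_1(\psi').$$ Both of the last inequalities are strict if at least one of the two inequalities between the error probabilities is strict. -/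

import Mathlib

open MeasureTheory
open scoped ENNReal NNReal

namespace GroupSequential

variable {𝔛 : Type*} {𝒢 : Set ℕ}

/-- The sample space `𝔛^n = 𝔛^{n₁} × ⋯ × 𝔛^{n_k}` of the first `k` groups, when their sizes
are `n = (n₁, …, n_k) ∈ 𝒢^k`. -/
abbrev Sample (𝔛 : Type*) {𝒢 : Set ℕ} {k : ℕ} (n : Fin k → 𝒢) : Type _ :=
  (i : Fin k) → Fin (n i : ℕ) → 𝔛

/-- The product measure `μ^n = μ^{n₁} ⊗ ⋯ ⊗ μ^{n_k}` on `𝔛^n`; the factor of an empty group is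
the probability measure on a one-point space. -/
noncomputable def sampleMeasure [MeasurableSpace 𝔛] (μ : Measure 𝔛) {k : ℕ} (n : Fin k → 𝒢) :
    Measure (Sample 𝔛 n) :=
  Measure.pi fun i => Measure.pi fun _ : Fin (n i : ℕ) => μ

/-- The joint density `f^{(n)}(x) = ∏ᵢ ∏ⱼ f(x_{ij})` on `𝔛^n`. -/
noncomputable def jointDensity (f : 𝔛 → ℝ≥0) {k : ℕ} (n : Fin k → 𝒢) (x : Sample 𝔛 n) : ℝ≥0 :=
  ∏ i : Fin k, ∏ j : Fin (n i : ℕ), f (x i j)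

/-- The law of the observations in the first `k` groups, given the group sizes `n ∈ 𝒢^k`, when a
single observation has density `f` with respect to `μ`. -/
noncomputable def sampleLaw [MeasurableSpace 𝔛] (μ : Measure 𝔛) (f : 𝔛 → ℝ≥0) {k : ℕ}
    (n : Fin k → 𝒢) : Measure (Sample 𝔛 n) :=
  (sampleMeasure μ n).withDensity fun x => (jointDensity f n x : ℝ≥0∞)

/-- The likelihood ratio `z_n = f₁^{(n)} / f₀^{(n)}`. With the division of `ℝ≥0∞` it is the
ordinary quotient where `f₀^{(n)} > 0`, it is `∞` where `f₀^{(n)} = 0 < f₁^{(n)}`, and it is `0`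
where both densities vanish. -/
noncomputable def likelihoodRatio (f : Fin 2 → 𝔛 → ℝ≥0) {k : ℕ} (n : Fin k → 𝒢)
    (x : Sample 𝔛 n) : ℝ≥0∞ :=
  (jointDensity (f 1) n x : ℝ≥0∞) / (jointDensity (f 0) n x : ℝ≥0∞)

/-- A family of measurable functions `𝔛^n → [0,1]`, one for each tuple `n` of `k + 1` group sizes,
`k ≥ 0` (so that there is always at least one group). As a stopping rule, its value is the
conditional probability to stop, given the group sizes and the data so far; as a decision rule, it
is the conditional probability to reject `H₀`. -/
structure RandomizedRule (𝔛 : Type*) [MeasurableSpace 𝔛] (𝒢 : Set ℕ) where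
  /-- The functions of the family. -/
  val : (k : ℕ) → (n : Fin (k + 1) → 𝒢) → Sample 𝔛 n → ℝ≥0∞
  measurable_val : ∀ k n, Measurable (val k n)
  le_one : ∀ k n x, val k n x ≤ 1

/-- The probability `p(n) = ∏ᵢ p(nᵢ)` that the first groups have sizes `n`. -/
noncomputable def sizeProb (p : PMF 𝒢) {k : ℕ} (n : Fin k → 𝒢) : ℝ≥0∞ := ∏ i, p (n i)

/-- The cost `c(n) = ∑ᵢ c(nᵢ)` of the groups of sizes `n`. -/
noncomputable def totalCost (c : 𝒢 → ℝ≥0) {k : ℕ} (n : Fin k → 𝒢) : ℝ≥0∞ :=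
  ∑ i, (c (n i) : ℝ≥0∞)

section Rules

variable [MeasurableSpace 𝔛]

/-- `t_n^ψ(x)`, for `n` of length `k + 1`: the product over `j = 1, …, k` of
`1 - ψ_{(n₁, …, n_j)}(x₁, …, x_j)`. -/
noncomputable def continueProb (ψ : RandomizedRule 𝔛 𝒢) {k : ℕ} (n : Fin (k + 1) → 𝒢)
    (x : Sample 𝔛 n) : ℝ≥0∞ :=
  ∏ j : Fin k, (1 - ψ.val j
    (fun i : Fin (j + 1) => n (i.castLE (Nat.succ_le_succ j.isLt.le)))
    (fun i : Fin (j + 1) => x (i.castLE (Nat.succ_le_succ j.isLt.le))))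

/-- `s_n^ψ = t_n^ψ ψ_n`. -/
noncomputable def stopProb (ψ : RandomizedRule 𝔛 𝒢) {k : ℕ} (n : Fin (k + 1) → 𝒢)
    (x : Sample 𝔛 n) : ℝ≥0∞ :=
  continueProb ψ n x * ψ.val k n x

/-- `ψ` terminates with probability one when an observation has density `f`:
`P(τ_ψ < ∞) = ∑_k ∑_n p(n) E s_n^ψ = 1`. -/
def Terminates (μ : Measure 𝔛) (f : 𝔛 → ℝ≥0) (p : PMF 𝒢) (ψ : RandomizedRule 𝔛 𝒢) : Prop :=
  ∑' (k : ℕ) (n : Fin (k + 1) → 𝒢), sizeProb p n * ∫⁻ x, stopProb ψ n x ∂(sampleLaw μ f n) = 1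

/-- The class `𝒮ᵢ` of the tests `(ψ, φ)` whose stopping rule terminates with probability one
under `Hᵢ`. -/
def testClass (μ : Measure 𝔛) (f : Fin 2 → 𝔛 → ℝ≥0) (p : PMF 𝒢) (i : Fin 2) :
    Set (RandomizedRule 𝔛 𝒢 × RandomizedRule 𝔛 𝒢) :=
  {T | Terminates μ (f i) p T.1}

/-- The type I error probability `α(ψ, φ) = ∑_k ∑_n p(n) E₀ s_n^ψ φ_n`. -/
noncomputable def typeIError (μ : Measure 𝔛) (f : Fin 2 → 𝔛 → ℝ≥0) (p : PMF 𝒢)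
    (ψ φ : RandomizedRule 𝔛 𝒢) : ℝ≥0∞ :=
  ∑' (k : ℕ) (n : Fin (k + 1) → 𝒢),
    sizeProb p n * ∫⁻ x, stopProb ψ n x * φ.val k n x ∂(sampleLaw μ (f 0) n)

/-- The type II error probability `β(ψ, φ) = ∑_k ∑_n p(n) E₁ s_n^ψ (1 - φ_n)`. -/
noncomputable def typeIIError (μ : Measure 𝔛) (f : Fin 2 → 𝔛 → ℝ≥0) (p : PMF 𝒢)
    (ψ φ : RandomizedRule 𝔛 𝒢) : ℝ≥0∞ :=
  ∑' (k : ℕ) (n : Fin (k + 1) → 𝒢),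
    sizeProb p n * ∫⁻ x, stopProb ψ n x * (1 - φ.val k n x) ∂(sampleLaw μ (f 1) n)

/-- The average cost `Kᵢ(ψ) = ∑_k ∑_n p(n) c(n) Eᵢ s_n^ψ` under `Hᵢ`, possibly infinite. -/
noncomputable def averageCost (μ : Measure 𝔛) (f : Fin 2 → 𝔛 → ℝ≥0) (p : PMF 𝒢) (c : 𝒢 → ℝ≥0)
    (i : Fin 2) (ψ : RandomizedRule 𝔛 𝒢) : ℝ≥0∞ :=
  ∑' (k : ℕ) (n : Fin (k + 1) → 𝒢),
    sizeProb p n * totalCost c n * ∫⁻ x, stopProb ψ n x ∂(sampleLaw μ (f i) n)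

end Rules

end GroupSequential

/-! The pair of joint densities (f₀^{(n)}, f₁^{(n)}) is a multiplicative random walk on the cone ℝ≥0
× ℝ≥0, whose step measure κ need not be finite. Both coordinates are harmonic, while the geometric
mean √(u₁u₂) is multiplied in the mean by a factor θ < 1 at each step, by strict AM-GM. Where the
ratio u₂/u₁ lies in [A, B] the geometric mean dominates both coordinates up to constants, so
survival in that region decays geometrically under both hypotheses.

By a Wald identity (`averageCost_le`, `le_averageCost`) the average cost of a terminating test is
the mean cost of a group times the sum of the probabilities of still being pending. It is therefore
enough to show that, for some positive l₀ and l₁, the given test minimizes Kᵢ + l₀α + l₁β. A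
competitor with no larger errors then cannot be cheaper, and a strict gain in an error must be paid
for in cost. Charging for observations under one hypothesis at a time yields the two inequalities
separately, with different l₀, l₁ for each.

The heart is `exists_value`: A and B are prescribed and the weights must be found. They are chosen
so that on the rays of ratio A and B, taking one more group and then following the A-B rule costs
exactly as much as accepting, respectively rejecting. This is a 2 × 2 linear system in the exit
masses of `exit_from_low` and `exit_from_high`, with positive determinant, so it has a positive
solution. Since the value function R can only improve on the A-B rule, continuing is at least as
good as stopping on the two rays; monotonicity and homogeneity of degree one spread this over the
cone between them. Conversely, the amounts by which stopping might be suboptimal on the two rays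
satisfy homogeneous inequalities with the same determinant and hence vanish; monotonicity then makes
stopping optimal outside the cone.

With R known, telescoping the expected value of R over the groups bounds the risk of any terminating
test from below (`continuationCost_le_risk`), and shows that the A-B rule attains the bound
(`risk_le_continuationCost`). -/

namespace GroupSequential

/-! ### Transition operator and potentials of the killed walk. -/

section Operator

/-- The transition operator `H ↦ ∫ H (u * w) dκ(w)` of a multiplicative random walk on the cone
`ℝ≥0 × ℝ≥0`. -/
noncomputable def transition (κ : Measure (ℝ≥0 × ℝ≥0)) (H : ℝ≥0 × ℝ≥0 → ℝ≥0∞)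
    (u : ℝ≥0 × ℝ≥0) : ℝ≥0∞ :=
  ∫⁻ w, H (u * w) ∂κ

variable {κ : Measure (ℝ≥0 × ℝ≥0)} {H H' r r' s : ℝ≥0 × ℝ≥0 → ℝ≥0∞} {C : Set (ℝ≥0 × ℝ≥0)}

theorem measurable_transition [SFinite κ] (hH : Measurable H) : Measurable (transition κ H) := by
  have : Measurable fun q : (ℝ≥0 × ℝ≥0) × (ℝ≥0 × ℝ≥0) => H (q.1 * q.2) :=
    hH.comp (by fun_prop)
  exact this.lintegral_prod_right'

theorem transition_mono (h : ∀ u, H u ≤ H' u) (u : ℝ≥0 × ℝ≥0) :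
    transition κ H u ≤ transition κ H' u :=
  lintegral_mono fun w => h (u * w)

theorem transition_add (hH : Measurable H) (u : ℝ≥0 × ℝ≥0) :
    transition κ (fun u => H u + H' u) u = transition κ H u + transition κ H' u :=
  lintegral_add_left (hH.comp (by fun_prop)) _

theorem transition_const_mul (b : ℝ≥0) (u : ℝ≥0 × ℝ≥0) :
    transition κ (fun u => b * H u) u = b * transition κ H u :=
  lintegral_const_mul' _ _ ENNReal.coe_ne_top

/-- The transition operator of the walk killed outside `C`. -/
noncomputable def killed (κ : Measure (ℝ≥0 × ℝ≥0)) (C : Set (ℝ≥0 × ℝ≥0))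
    (H : ℝ≥0 × ℝ≥0 → ℝ≥0∞) : ℝ≥0 × ℝ≥0 → ℝ≥0∞ :=
  transition κ (C.indicator H)

theorem measurable_killed [SFinite κ] (hC : MeasurableSet C) (hH : Measurable H) :
    Measurable (killed κ C H) :=
  measurable_transition (hH.indicator hC)

theorem killed_mono_on (h : ∀ u ∈ C, H u ≤ H' u) (u : ℝ≥0 × ℝ≥0) :
    killed κ C H u ≤ killed κ C H' u := by
  refine transition_mono (fun v => ?_) u
  by_cases hv : v ∈ C <;> simp [hv, h]

theorem killed_mono (h : ∀ u, H u ≤ H' u) (u : ℝ≥0 × ℝ≥0) :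
    killed κ C H u ≤ killed κ C H' u :=
  killed_mono_on (fun u _ => h u) u

theorem killed_le_transition (u : ℝ≥0 × ℝ≥0) : killed κ C H u ≤ transition κ H u :=
  transition_mono (fun v => Set.indicator_le_self _ _ v) u

theorem killed_add (hC : MeasurableSet C) (hH : Measurable H) (u : ℝ≥0 × ℝ≥0) :
    killed κ C (fun u => H u + H' u) u = killed κ C H u + killed κ C H' u := by
  rw [killed, killed, killed, ← transition_add (hH.indicator hC)]
  congr 1
  ext v
  by_cases hv : v ∈ C <;> simp [hv]

theorem killed_const_mul (b : ℝ≥0) (u : ℝ≥0 × ℝ≥0) :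
    killed κ C (fun u => b * H u) u = b * killed κ C H u := by
  rw [killed, killed, ← transition_const_mul]
  congr 1
  ext v
  by_cases hv : v ∈ C <;> simp [hv]

theorem measurable_killed_iterate [SFinite κ] (hC : MeasurableSet C) (hH : Measurable H) (j : ℕ) :
    Measurable ((killed κ C)^[j] H) := by
  induction j with
  | zero => exact hH
  | succ j ih => rw [Function.iterate_succ_apply']; exact measurable_killed hC ih

theorem killed_iterate_mono (h : ∀ u, H u ≤ H' u) (j : ℕ) (u : ℝ≥0 × ℝ≥0) :
    (killed κ C)^[j] H u ≤ (killed κ C)^[j] H' u := by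
  induction j generalizing u with
  | zero => exact h u
  | succ j ih =>
    rw [Function.iterate_succ_apply', Function.iterate_succ_apply']
    exact killed_mono ih u

theorem killed_iterate_add [SFinite κ] (hC : MeasurableSet C) (hH : Measurable H) (j : ℕ) :
    (killed κ C)^[j] (fun u => H u + H' u)
      = fun u => (killed κ C)^[j] H u + (killed κ C)^[j] H' u := by
  induction j with
  | zero => rfl
  | succ j ih =>
    ext u
    rw [Function.iterate_succ_apply', Function.iterate_succ_apply', Function.iterate_succ_apply',
      ih, killed_add hC (measurable_killed_iterate hC hH j)]

theorem killed_iterate_const_mul (b : ℝ≥0) (j : ℕ) :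
    (killed κ C)^[j] (fun u => b * H u) = fun u => b * (killed κ C)^[j] H u := by
  induction j with
  | zero => rfl
  | succ j ih =>
    ext u
    rw [Function.iterate_succ_apply', Function.iterate_succ_apply', ih, killed_const_mul]

/-- The potential `∑ⱼ Qʲ r` of the killed walk, `Q` the operator `killed κ C`. -/
noncomputable def potential (κ : Measure (ℝ≥0 × ℝ≥0)) (C : Set (ℝ≥0 × ℝ≥0))
    (r : ℝ≥0 × ℝ≥0 → ℝ≥0∞) (u : ℝ≥0 × ℝ≥0) : ℝ≥0∞ :=
  ∑' j, (killed κ C)^[j] r u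

theorem le_potential (u : ℝ≥0 × ℝ≥0) : r u ≤ potential κ C r u :=
  ENNReal.le_tsum (f := fun j => (killed κ C)^[j] r u) 0

theorem potential_mono (h : ∀ u, r u ≤ r' u) (u : ℝ≥0 × ℝ≥0) :
    potential κ C r u ≤ potential κ C r' u :=
  ENNReal.tsum_le_tsum fun j => killed_iterate_mono h j u

theorem potential_add [SFinite κ] (hC : MeasurableSet C) (hr : Measurable r) (u : ℝ≥0 × ℝ≥0) :
    potential κ C (fun u => r u + r' u) u = potential κ C r u + potential κ C r' u := by
  simp only [potential, killed_iterate_add hC hr]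
  exact ENNReal.tsum_add

theorem potential_const_mul (b : ℝ≥0) (u : ℝ≥0 × ℝ≥0) :
    potential κ C (fun u => b * r u) u = b * potential κ C r u := by
  simp only [potential, killed_iterate_const_mul]
  exact ENNReal.tsum_mul_left

theorem sum_add_killed_iterate_le [SFinite κ] (hC : MeasurableSet C) (hs : Measurable s)
    (h : ∀ u, s u + killed κ C H u ≤ H u) (j : ℕ) (u : ℝ≥0 × ℝ≥0) :
    ∑ i ∈ Finset.range j, (killed κ C)^[i] s u + (killed κ C)^[j] H u ≤ H u := by
  induction j with
  | zero => simp
  | succ j ih =>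
    refine le_trans ?_ ih
    rw [Finset.sum_range_succ, add_assoc]
    gcongr
    have := killed_iterate_mono (κ := κ) (C := C) h j u
    rwa [killed_iterate_add hC hs] at this

/-- Iterating the supersolution inequality leaves a nonnegative remainder Qʲ H, which is dropped; no
decay is needed in this direction. -/
theorem potential_le [SFinite κ] (hC : MeasurableSet C) (hs : Measurable s)
    (h : ∀ u, s u + killed κ C H u ≤ H u) (u : ℝ≥0 × ℝ≥0) :
    potential κ C s u ≤ H u := by
  rw [potential, ENNReal.tsum_eq_iSup_nat]
  exact iSup_le fun j => le_self_add.trans (sum_add_killed_iterate_le hC hs h j u)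

theorem le_sum_add_killed_iterate [SFinite κ] (hC : MeasurableSet C) (hr : Measurable r)
    (h : ∀ u, H u ≤ r u + killed κ C H u) (j : ℕ) (u : ℝ≥0 × ℝ≥0) :
    H u ≤ ∑ i ∈ Finset.range j, (killed κ C)^[i] r u + (killed κ C)^[j] H u := by
  induction j with
  | zero => simp
  | succ j ih =>
    refine ih.trans ?_
    rw [Finset.sum_range_succ, add_assoc]
    gcongr
    have := killed_iterate_mono (κ := κ) (C := C) h j u
    rwa [killed_iterate_add hC hr] at this

/-- One application of the killed operator looks at its argument only on `C`, so a bound on `C`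
suffices from the first iterate on. -/
theorem killed_iterate_succ_le {g : ℝ≥0 × ℝ≥0 → ℝ≥0∞} {M : ℝ≥0} (h : ∀ u ∈ C, H u ≤ M * g u)
    (j : ℕ) (u : ℝ≥0 × ℝ≥0) :
    (killed κ C)^[j + 1] H u ≤ M * (killed κ C)^[j + 1] g u := by
  rw [← congrFun (killed_iterate_const_mul (κ := κ) (C := C) (H := g) M (j + 1)) u,
    Function.iterate_succ_apply, Function.iterate_succ_apply]
  exact killed_iterate_mono (killed_mono_on h) j u

theorem potential_ne_top_of_le_on {g : ℝ≥0 × ℝ≥0 → ℝ≥0∞} {M : ℝ≥0} {u : ℝ≥0 × ℝ≥0}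
    (h : ∀ u ∈ C, H u ≤ M * g u) (hg : potential κ C g u ≠ ∞) (hH : H u ≠ ∞) :
    potential κ C H u ≠ ∞ := by
  have h1 : potential κ C H u ≤ H u + M * potential κ C g u := by
    rw [potential, tsum_eq_zero_add' ENNReal.summable]
    refine add_le_add le_rfl ?_
    calc ∑' j, (killed κ C)^[j + 1] H u ≤ ∑' j, M * (killed κ C)^[j + 1] g u :=
          ENNReal.tsum_le_tsum fun j => killed_iterate_succ_le h j u
      _ = M * ∑' j, (killed κ C)^[j + 1] g u := ENNReal.tsum_mul_left
      _ ≤ M * potential κ C g u := by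
          gcongr
          exact ENNReal.tsum_comp_le_tsum_of_injective (add_left_injective 1)
            (fun j => (killed κ C)^[j] g u)
  exact ne_top_of_le_ne_top
    (ENNReal.add_ne_top.2 ⟨hH, ENNReal.mul_ne_top ENNReal.coe_ne_top hg⟩) h1

/-- Here the remainder Qʲ H has to vanish. It does because it is at most `M` times a term of the
convergent series for the potential of `g`. -/
theorem le_potential_of_le_add_killed [SFinite κ] {g : ℝ≥0 × ℝ≥0 → ℝ≥0∞} {M : ℝ≥0}
    {u : ℝ≥0 × ℝ≥0} (hC : MeasurableSet C) (hr : Measurable r)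
    (hH : ∀ u, H u ≤ r u + killed κ C H u)
    (h : ∀ u ∈ C, H u ≤ M * g u) (hg : potential κ C g u ≠ ∞) :
    H u ≤ potential κ C r u := by
  have hlim : Filter.Tendsto (fun j => potential κ C r u + M * (killed κ C)^[j + 1] g u)
      Filter.atTop (nhds (potential κ C r u + M * 0)) := by
    refine Filter.Tendsto.const_add _ ?_
    refine ENNReal.Tendsto.const_mul ?_ (Or.inr ENNReal.coe_ne_top)
    exact (Filter.tendsto_add_atTop_iff_nat 1).2 (ENNReal.tendsto_atTop_zero_of_tsum_ne_top hg)
  rw [mul_zero, add_zero] at hlim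
  refine ge_of_tendsto' hlim fun j => ?_
  refine (le_sum_add_killed_iterate hC hr hH (j + 1) u).trans ?_
  exact add_le_add (ENNReal.sum_le_tsum _) (killed_iterate_succ_le h j u)

end Operator

end GroupSequential

/-! ### The multiplier system, the three regions, and harmonic functions of the walk. -/

namespace GroupSequential

theorem mul_lt_mul_of_ratio_bounds {A B γ a a' β : ℝ≥0} (hAB : A < B) (hγ : 0 < γ) (ha' : 0 < a')
    (h₁ : B * a ≤ γ) (h₂ : β ≤ A * a') : a * β < γ * a' := by
  have hB : 0 < B := pos_of_gt hAB
  have hpos : 0 < γ * a' := mul_pos hγ ha'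
  have : B * (a * β) < B * (γ * a') :=
    calc B * (a * β) = (B * a) * β := by ring
      _ ≤ γ * (A * a') := mul_le_mul' h₁ h₂
      _ = A * (γ * a') := by ring
      _ < B * (γ * a') := by gcongr
  exact lt_of_mul_lt_mul_left this hB.le

theorem exists_multipliers {γ a a' β n₁ n₂ : ℝ≥0} (hγ : 0 < γ) (ha' : 0 < a')
    (hdet : a * β < γ * a') (hn₁ : 0 < n₁) (hn₂ : 0 < n₂) :
    ∃ x y : ℝ≥0, 0 < x ∧ 0 < y ∧ x * γ = n₁ + y * a ∧ y * a' = n₂ + x * β := by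
  have hD : 0 < γ * a' - a * β := tsub_pos_of_lt hdet
  -- Cramer's rule, with the determinant γa' − aβ.
  refine ⟨(n₁ * a' + a * n₂) / (γ * a' - a * β), (γ * n₂ + n₁ * β) / (γ * a' - a * β),
    div_pos (add_pos_of_pos_of_nonneg (mul_pos hn₁ ha') zero_le) hD,
    div_pos (add_pos_of_pos_of_nonneg (mul_pos hγ hn₂) zero_le) hD, ?_, ?_⟩
  all_goals
    rw [← NNReal.coe_inj]
    push_cast [NNReal.coe_sub hdet.le]
    have hD' : (γ : ℝ) * a' - a * β ≠ 0 := sub_ne_zero.2 (by exact_mod_cast hdet.ne')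
    obtain ⟨D, hD''⟩ : ∃ D : ℝ, D = γ * a' - a * β := ⟨_, rfl⟩
    rw [← hD''] at hD' ⊢
    field_simp
  · linear_combination (-n₁ : ℝ) * hD''
  · linear_combination (-n₂ : ℝ) * hD''

/-- Chaining the two inequalities multiplies `x` by at most aβ/(γa') < 1, which forces it to vanish.
-/
theorem eq_zero_of_mul_le_mul {γ a a' β x y : ℝ≥0} (ha' : 0 < a')
    (hdet : a * β < γ * a') (h₁ : x * γ ≤ y * a) (h₂ : y * a' ≤ x * β) : x = 0 ∧ y = 0 := by
  have hx : x = 0 := by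
    by_contra hx
    have : x * (γ * a') ≤ x * (a * β) :=
      calc x * (γ * a') = x * γ * a' := by ring
        _ ≤ y * a * a' := by gcongr
        _ = y * a' * a := by ring
        _ ≤ x * β * a := by gcongr
        _ = x * (a * β) := by ring
    exact absurd (le_of_mul_le_mul_left this (pos_iff_ne_zero.2 hx)) (not_le.2 hdet)
  refine ⟨hx, ?_⟩
  rw [hx, zero_mul] at h₂
  exact (mul_eq_zero.1 (le_antisymm h₂ zero_le)).resolve_right ha'.ne'

/-- The states with likelihood ratio at most `A`. -/
def lowRegion (A : ℝ≥0) : Set (ℝ≥0 × ℝ≥0) := {u | u.2 ≤ A * u.1}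

/-- The states with likelihood ratio strictly between `A` and `B`. -/
def midRegion (A B : ℝ≥0) : Set (ℝ≥0 × ℝ≥0) := {u | A * u.1 < u.2 ∧ u.2 < B * u.1}

/-- The states with likelihood ratio at least `B`. -/
def highRegion (A B : ℝ≥0) : Set (ℝ≥0 × ℝ≥0) := {u | A * u.1 < u.2 ∧ B * u.1 ≤ u.2}

theorem measurableSet_lowRegion (A : ℝ≥0) : MeasurableSet (lowRegion A) :=
  measurableSet_le (by fun_prop) (by fun_prop)

theorem measurableSet_midRegion (A B : ℝ≥0) : MeasurableSet (midRegion A B) :=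
  (measurableSet_lt (by fun_prop) (by fun_prop)).inter
    (measurableSet_lt (by fun_prop) (by fun_prop))

theorem measurableSet_highRegion (A B : ℝ≥0) : MeasurableSet (highRegion A B) :=
  (measurableSet_lt (by fun_prop) (by fun_prop)).inter
    (measurableSet_le (by fun_prop) (by fun_prop))

/-- The origin satisfies both weak inequalities; the strict condition in `highRegion` assigns it to
the low region alone, so the three regions form a partition whatever the order of `A` and `B`. -/
theorem region_cases (A B : ℝ≥0) (u : ℝ≥0 × ℝ≥0) :
    (u ∈ lowRegion A ∧ u ∉ midRegion A B ∧ u ∉ highRegion A B) ∨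
    (u ∉ lowRegion A ∧ u ∈ midRegion A B ∧ u ∉ highRegion A B) ∨
    (u ∉ lowRegion A ∧ u ∉ midRegion A B ∧ u ∈ highRegion A B) := by
  simp only [lowRegion, midRegion, highRegion, Set.mem_ofPred_eq]
  grind

variable {κ : Measure (ℝ≥0 × ℝ≥0)} {H : ℝ≥0 × ℝ≥0 → ℝ≥0∞}

theorem transition_eq_add_killed (A B : ℝ≥0) (hH : Measurable H) (u : ℝ≥0 × ℝ≥0) :
    transition κ H u = transition κ ((lowRegion A).indicator H) u
      + transition κ ((highRegion A B).indicator H) u + killed κ (midRegion A B) H u := by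
  rw [killed, ← transition_add (hH.indicator (measurableSet_lowRegion A)),
    ← transition_add (H := fun u => (lowRegion A).indicator H u + (highRegion A B).indicator H u)
      ((hH.indicator (measurableSet_lowRegion A)).add
        (hH.indicator (measurableSet_highRegion A B)))]
  congr 1
  ext v
  rcases region_cases A B v with ⟨h1, h2, h3⟩ | ⟨h1, h2, h3⟩ | ⟨h1, h2, h3⟩ <;> simp [h1, h2, h3]

/-- The geometric mean of the two densities. -/
noncomputable def geomMean (u : ℝ≥0 × ℝ≥0) : ℝ≥0∞ := (NNReal.sqrt (u.1 * u.2) : ℝ≥0)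

theorem measurable_geomMean : Measurable geomMean := by
  unfold geomMean; fun_prop

theorem geomMean_mul (u w : ℝ≥0 × ℝ≥0) : geomMean (u * w) = geomMean u * geomMean w := by
  simp only [geomMean, Prod.fst_mul, Prod.snd_mul]
  rw [mul_mul_mul_comm, NNReal.sqrt_mul, ENNReal.coe_mul]

theorem fst_mul_sqrt_le_geomMean {b : ℝ≥0} {u : ℝ≥0 × ℝ≥0} (h : b * u.1 ≤ u.2) :
    (NNReal.sqrt b : ℝ≥0∞) * u.1 ≤ geomMean u := by
  rw [geomMean, ← ENNReal.coe_mul, ENNReal.coe_le_coe]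
  calc NNReal.sqrt b * u.1 = NNReal.sqrt (u.1 * (b * u.1)) := by
        rw [show u.1 * (b * u.1) = b * (u.1 * u.1) by ring, NNReal.sqrt_mul, NNReal.sqrt_mul_self]
    _ ≤ _ := by gcongr

theorem snd_le_sqrt_mul_geomMean {b : ℝ≥0} {u : ℝ≥0 × ℝ≥0} (h : u.2 ≤ b * u.1) :
    (u.2 : ℝ≥0∞) ≤ NNReal.sqrt b * geomMean u := by
  rw [geomMean, ← ENNReal.coe_mul, ENNReal.coe_le_coe, ← NNReal.sqrt_mul]
  calc u.2 = NNReal.sqrt (u.2 * u.2) := by rw [NNReal.sqrt_mul_self]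
    _ ≤ NNReal.sqrt (b * u.1 * u.2) := by gcongr
    _ = _ := by rw [mul_assoc]

theorem fst_le_inv_sqrt_mul_geomMean {b : ℝ≥0} (hb : 0 < b) {u : ℝ≥0 × ℝ≥0}
    (h : b * u.1 ≤ u.2) :
    (u.1 : ℝ≥0∞) ≤ ((NNReal.sqrt b)⁻¹ : ℝ≥0) * geomMean u := by
  have h1 := mul_le_mul_right (fst_mul_sqrt_le_geomMean h) (((NNReal.sqrt b)⁻¹ : ℝ≥0) : ℝ≥0∞)
  rwa [← mul_assoc, ← ENNReal.coe_mul, inv_mul_cancel₀ (NNReal.sqrt_pos.2 hb).ne',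
    ENNReal.coe_one, one_mul] at h1

/-- A multiplicative step whose coordinates have mean one, so that the two coordinates of the walk
are martingales, and whose geometric mean is less than one, so that the coordinates separate. -/
structure IsLikelihoodStep (κ : Measure (ℝ≥0 × ℝ≥0)) : Prop where
  lintegral_fst : ∫⁻ w, (w.1 : ℝ≥0∞) ∂κ = 1
  lintegral_snd : ∫⁻ w, (w.2 : ℝ≥0∞) ∂κ = 1
  lintegral_geomMean_lt : ∫⁻ w, geomMean w ∂κ < 1

theorem transition_fst (hκ : IsLikelihoodStep κ) (u : ℝ≥0 × ℝ≥0) :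
    transition κ (fun u => (u.1 : ℝ≥0∞)) u = u.1 := by
  simp only [transition, Prod.fst_mul, ENNReal.coe_mul]
  rw [lintegral_const_mul' _ _ ENNReal.coe_ne_top, hκ.lintegral_fst, mul_one]

theorem transition_snd (hκ : IsLikelihoodStep κ) (u : ℝ≥0 × ℝ≥0) :
    transition κ (fun u => (u.2 : ℝ≥0∞)) u = u.2 := by
  simp only [transition, Prod.snd_mul, ENNReal.coe_mul]
  rw [lintegral_const_mul' _ _ ENNReal.coe_ne_top, hκ.lintegral_snd, mul_one]

theorem transition_geomMean (u : ℝ≥0 × ℝ≥0) :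
    transition κ geomMean u = (∫⁻ w, geomMean w ∂κ) * geomMean u := by
  simp only [transition, geomMean_mul]
  rw [lintegral_const_mul' _ _ (by simp [geomMean]), mul_comm]

/-- In the middle region u₁ ≤ A^{-1/2}√(u₁u₂), and the iterates of the geometric mean are dominated
by a geometric series of ratio θ. -/
theorem potential_fst_ne_top (hκ : IsLikelihoodStep κ) {A : ℝ≥0} (hA : 0 < A) (B : ℝ≥0)
    (u : ℝ≥0 × ℝ≥0) : potential κ (midRegion A B) (fun u => (u.1 : ℝ≥0∞)) u ≠ ∞ := by
  have hθ := hκ.lintegral_geomMean_lt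
  obtain ⟨θ, hθ'⟩ := ENNReal.lt_iff_exists_coe.1 hθ |>.imp fun _ h => h.1.symm
  have hθ1 : (θ : ℝ≥0∞) < 1 := hθ' ▸ hθ
  have hiter : ∀ j u, (killed κ (midRegion A B))^[j] geomMean u ≤ (θ : ℝ≥0∞) ^ j * geomMean u := by
    intro j
    induction j with
    | zero => intro u; simp
    | succ j ih =>
      intro u
      rw [Function.iterate_succ_apply']
      calc _ ≤ killed κ (midRegion A B) (fun u => ((θ ^ j : ℝ≥0) : ℝ≥0∞) * geomMean u) u :=
            killed_mono (fun u => by simpa using ih u) u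
        _ = ((θ ^ j : ℝ≥0) : ℝ≥0∞) * killed κ (midRegion A B) geomMean u := killed_const_mul _ _
        _ ≤ ((θ ^ j : ℝ≥0) : ℝ≥0∞) * transition κ geomMean u := by
            gcongr; exact killed_le_transition u
        _ = (θ : ℝ≥0∞) ^ (j + 1) * geomMean u := by
            rw [transition_geomMean, ← hθ']; push_cast; ring
  have hg : potential κ (midRegion A B) geomMean u ≠ ∞ := by
    refine ne_top_of_le_ne_top ?_ (ENNReal.tsum_le_tsum fun j => hiter j u)
    rw [ENNReal.tsum_mul_right, ENNReal.tsum_geometric]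
    refine ENNReal.mul_ne_top (ENNReal.inv_ne_top.2 (tsub_pos_of_lt hθ1).ne') (by simp [geomMean])
  exact potential_ne_top_of_le_on (M := (NNReal.sqrt A)⁻¹)
    (fun u hu => fst_le_inv_sqrt_mul_geomMean hA hu.1.le) hg ENNReal.coe_ne_top

/-- Optional stopping for a harmonic function: its value is split between the two ways of leaving
the middle region, and nothing is lost at infinity since `H` is controlled there by the first
coordinate, whose potential is finite. -/
theorem potential_low_add_high [SFinite κ] (hκ : IsLikelihoodStep κ) {A : ℝ≥0} (hA : 0 < A)
    (B : ℝ≥0) {M : ℝ≥0} (hH : Measurable H) (hTH : ∀ u, transition κ H u = H u)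
    (hM : ∀ u ∈ midRegion A B, H u ≤ M * u.1) (u : ℝ≥0 × ℝ≥0) :
    potential κ (midRegion A B) (transition κ ((lowRegion A).indicator H)) u
      + potential κ (midRegion A B) (transition κ ((highRegion A B).indicator H)) u = H u := by
  have hlo := measurable_transition (κ := κ) (hH.indicator (measurableSet_lowRegion A))
  have hhi := measurable_transition (κ := κ) (hH.indicator (measurableSet_highRegion A B))
  have hmid := measurableSet_midRegion A B
  rw [← potential_add (κ := κ) hmid hlo]
  have hdec := fun u => (hTH u).symm.trans (transition_eq_add_killed (κ := κ) A B hH u)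
  refine le_antisymm (potential_le hmid (hlo.add hhi) (fun u => (hdec u).ge) u) ?_
  exact le_potential_of_le_add_killed hmid (hlo.add hhi) (fun u => (hdec u).le) hM
    (potential_fst_ne_top hκ hA B u)

/-- With g the geometric mean, 1_S g + 1_mid θg ≤ g pointwise, and one transition turns g into θg.
So θg is a supersolution. The factor θ < 1 comes from the forced first step and is what makes the
exit masses below strictly positive. -/
theorem potential_geomMean_le [SFinite κ] (hκ : IsLikelihoodStep κ) (A B : ℝ≥0)
    {S : Set (ℝ≥0 × ℝ≥0)} (hS : MeasurableSet S) (hd : Disjoint S (midRegion A B))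
    (u : ℝ≥0 × ℝ≥0) :
    potential κ (midRegion A B) (transition κ (S.indicator geomMean)) u
      ≤ (∫⁻ w, geomMean w ∂κ) * geomMean u := by
  have hθ := hκ.lintegral_geomMean_lt
  refine potential_le (κ := κ) (H := fun u => (∫⁻ w, geomMean w ∂κ) * geomMean u)
    (measurableSet_midRegion A B)
    (measurable_transition (κ := κ) (measurable_geomMean.indicator hS)) (fun u => ?_) u
  refine le_trans ?_ (transition_geomMean u).le
  rw [killed, ← transition_add (measurable_geomMean.indicator hS)]
  refine transition_mono (fun v => ?_) u
  by_cases hv : v ∈ S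
  · simp [hv, Set.disjoint_left.1 hd hv]
  · simp only [hv, not_false_eq_true, Set.indicator_of_notMem, zero_add]
    refine (Set.indicator_le_self _ _ v).trans ?_
    exact mul_le_of_le_one_left zero_le hθ.le

end GroupSequential

/-! ### Exit masses from the two boundary rays. -/

namespace GroupSequential

variable {κ : Measure (ℝ≥0 × ℝ≥0)}

/-- The walk starts on the lower boundary, makes one forced step and then runs until it leaves the
middle region. Here `a` is the mass leaving upwards under H₀, and `β`, `γ` are the masses leaving
downwards and upwards under H₁. Below the ray u₂ ≤ √A·√(u₁u₂), and the geometric mean at (1, A) is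
√A, so β ≤ θA < A and some H₁-mass must leave upwards. -/
theorem exit_from_low [SFinite κ] (hκ : IsLikelihoodStep κ) {A B : ℝ≥0} (hA : 0 < A) :
    ∃ a β γ : ℝ≥0, β + γ = A ∧ B * a ≤ γ ∧ 0 < γ ∧
      potential κ (midRegion A B) (transition κ ((highRegion A B).indicator fun u => u.1)) (1, A)
        = a ∧
      potential κ (midRegion A B) (transition κ ((lowRegion A).indicator fun u => u.2)) (1, A)
        = β := by
  have hsum := potential_low_add_high hκ hA B (M := B) (H := fun u => (u.2 : ℝ≥0∞))
    (by fun_prop) (transition_snd hκ) (fun u hu => by exact_mod_cast hu.2.le) (1, A)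
  have hsum' := potential_low_add_high hκ hA B (M := 1) (H := fun u => (u.1 : ℝ≥0∞))
    (by fun_prop) (transition_fst hκ) (fun u hu => by simp) (1, A)
  have hB : B * potential κ (midRegion A B)
      (transition κ ((highRegion A B).indicator fun u => u.1)) (1, A)
      ≤ potential κ (midRegion A B)
        (transition κ ((highRegion A B).indicator fun u => u.2)) (1, A) := by
    rw [← potential_const_mul]
    refine potential_mono (fun u => ?_) _
    rw [← transition_const_mul]
    refine transition_mono (fun v => ?_) u
    by_cases hv : v ∈ highRegion A B
    · simpa [hv] using (by exact_mod_cast hv.2 : (B : ℝ≥0∞) * v.1 ≤ v.2)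
    · simp [hv]
  have hlow : potential κ (midRegion A B)
      (transition κ ((lowRegion A).indicator fun u => u.2)) (1, A)
      ≤ (∫⁻ w, geomMean w ∂κ) * A := by
    have hd : Disjoint (lowRegion A) (midRegion A B) :=
      Set.disjoint_left.2 fun u hu hu' => absurd hu'.1 (not_lt.2 hu)
    calc _ ≤ NNReal.sqrt A * potential κ (midRegion A B)
          (transition κ ((lowRegion A).indicator geomMean)) (1, A) := by
          rw [← potential_const_mul]
          refine potential_mono (fun u => ?_) _
          rw [← transition_const_mul]
          refine transition_mono (fun v => ?_) u
          by_cases hv : v ∈ lowRegion A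
          · simpa [hv] using snd_le_sqrt_mul_geomMean hv
          · simp [hv]
      _ ≤ NNReal.sqrt A * ((∫⁻ w, geomMean w ∂κ) * geomMean (1, A)) := by
          gcongr
          exact potential_geomMean_le hκ A B (measurableSet_lowRegion A) hd _
      _ = (∫⁻ w, geomMean w ∂κ) * A := by
          rw [mul_left_comm, geomMean, ← ENNReal.coe_mul]
          simp
  have hlt : (∫⁻ w, geomMean w ∂κ) * A < A := by
    have := (ENNReal.mul_lt_mul_iff_left (c := (A : ℝ≥0∞)) (by simpa using hA.ne')
      ENNReal.coe_ne_top).2 hκ.lintegral_geomMean_lt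
    rwa [one_mul] at this
  generalize potential κ (midRegion A B)
      (transition κ ((highRegion A B).indicator fun u => u.1)) (1, A) = a at *
  generalize potential κ (midRegion A B)
      (transition κ ((highRegion A B).indicator fun u => u.2)) (1, A) = γ at *
  generalize potential κ (midRegion A B)
      (transition κ ((lowRegion A).indicator fun u => u.2)) (1, A) = β at *
  have hβ : β ≠ ∞ := ne_top_of_le_ne_top ENNReal.coe_ne_top (le_self_add.trans hsum.le)
  have hγ : γ ≠ ∞ := ne_top_of_le_ne_top ENNReal.coe_ne_top (le_add_self.trans hsum.le)
  have ha : a ≠ ∞ := ne_top_of_le_ne_top ENNReal.coe_ne_top (le_add_self.trans hsum'.le)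
  lift β to ℝ≥0 using hβ
  lift γ to ℝ≥0 using hγ
  lift a to ℝ≥0 using ha
  have hs : β + γ = A := by exact_mod_cast hsum
  have hβA : β < A := by exact_mod_cast hlow.trans_lt hlt
  refine ⟨a, β, γ, hs, by exact_mod_cast hB, ?_, rfl, rfl⟩
  rw [← hs] at hβA
  exact pos_of_lt_add_right hβA

/-- The mirror image, started on the upper boundary: the geometric mean now bounds the H₀-mass `a`
leaving upwards by θ < 1, so the H₀-mass `a'` leaving downwards is positive. -/
theorem exit_from_high [SFinite κ] (hκ : IsLikelihoodStep κ) {A B : ℝ≥0} (hA : 0 < A)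
    (hAB : A < B) :
    ∃ a β a' : ℝ≥0, a + a' = 1 ∧ β ≤ A * a' ∧ 0 < a' ∧
      potential κ (midRegion A B) (transition κ ((highRegion A B).indicator fun u => u.1)) (1, B)
        = a ∧
      potential κ (midRegion A B) (transition κ ((lowRegion A).indicator fun u => u.2)) (1, B)
        = β := by
  have hsum := potential_low_add_high hκ hA B (M := B) (H := fun u => (u.2 : ℝ≥0∞))
    (by fun_prop) (transition_snd hκ) (fun u hu => by exact_mod_cast hu.2.le) (1, B)
  have hsum' := potential_low_add_high hκ hA B (M := 1) (H := fun u => (u.1 : ℝ≥0∞))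
    (by fun_prop) (transition_fst hκ) (fun u hu => by simp) (1, B)
  have hlow : potential κ (midRegion A B)
      (transition κ ((lowRegion A).indicator fun u => u.2)) (1, B)
      ≤ A * potential κ (midRegion A B)
        (transition κ ((lowRegion A).indicator fun u => u.1)) (1, B) := by
    rw [← potential_const_mul]
    refine potential_mono (fun u => ?_) _
    rw [← transition_const_mul]
    refine transition_mono (fun v => ?_) u
    by_cases hv : v ∈ lowRegion A
    · simpa [hv] using (by exact_mod_cast hv : (v.2 : ℝ≥0∞) ≤ A * v.1)
    · simp [hv]
  have hhigh : NNReal.sqrt B * potential κ (midRegion A B)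
      (transition κ ((highRegion A B).indicator fun u => u.1)) (1, B)
      ≤ NNReal.sqrt B * ∫⁻ w, geomMean w ∂κ := by
    have hd : Disjoint (highRegion A B) (midRegion A B) :=
      Set.disjoint_left.2 fun u hu hu' => absurd hu'.2 (not_lt.2 hu.2)
    calc _ ≤ potential κ (midRegion A B)
          (transition κ ((highRegion A B).indicator geomMean)) (1, B) := by
          rw [← potential_const_mul]
          refine potential_mono (fun u => ?_) _
          rw [← transition_const_mul]
          refine transition_mono (fun v => ?_) u
          by_cases hv : v ∈ highRegion A B
          · simpa [hv] using fst_mul_sqrt_le_geomMean hv.2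
          · simp [hv]
      _ ≤ (∫⁻ w, geomMean w ∂κ) * geomMean (1, B) :=
          potential_geomMean_le hκ A B (measurableSet_highRegion A B) hd _
      _ = NNReal.sqrt B * ∫⁻ w, geomMean w ∂κ := by
          rw [mul_comm, geomMean]
          simp
  have hsB : 0 < NNReal.sqrt B := NNReal.sqrt_pos.2 (hA.trans hAB)
  rw [ENNReal.mul_le_mul_iff_right (by simpa using hsB.ne') ENNReal.coe_ne_top] at hhigh
  replace hhigh := hhigh.trans_lt hκ.lintegral_geomMean_lt
  generalize potential κ (midRegion A B)
      (transition κ ((highRegion A B).indicator fun u => u.1)) (1, B) = a at *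
  generalize potential κ (midRegion A B)
      (transition κ ((lowRegion A).indicator fun u => u.1)) (1, B) = a' at *
  generalize potential κ (midRegion A B)
      (transition κ ((lowRegion A).indicator fun u => u.2)) (1, B) = β at *
  have hβ : β ≠ ∞ := ne_top_of_le_ne_top ENNReal.coe_ne_top (le_self_add.trans hsum.le)
  have ha : a ≠ ∞ := ne_top_of_le_ne_top ENNReal.coe_ne_top (le_add_self.trans hsum'.le)
  have ha' : a' ≠ ∞ := ne_top_of_le_ne_top ENNReal.coe_ne_top (le_self_add.trans hsum'.le)
  lift β to ℝ≥0 using hβ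
  lift a' to ℝ≥0 using ha'
  lift a to ℝ≥0 using ha
  have hs : a' + a = 1 := by exact_mod_cast hsum'
  have ha1 : a < 1 := by exact_mod_cast hhigh
  refine ⟨a, β, a', by rw [add_comm, hs], by exact_mod_cast hlow, ?_, rfl, rfl⟩
  rw [← hs] at ha1
  exact pos_of_lt_add_left ha1

/-! ### Value function: Bellman equation, monotonicity, homogeneity. -/

/-- The value functions of the stopping problems with finite horizon, running cost `k` and
terminal loss `G`. -/
noncomputable def valueIter (κ : Measure (ℝ≥0 × ℝ≥0)) (k G : ℝ≥0 × ℝ≥0 → ℝ≥0∞) :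
    ℕ → ℝ≥0 × ℝ≥0 → ℝ≥0∞
  | 0 => G
  | j + 1 => fun u => min (G u) (k u + transition κ (valueIter κ k G j) u)

/-- The value function of the stopping problem with infinite horizon. -/
noncomputable def value (κ : Measure (ℝ≥0 × ℝ≥0)) (k G : ℝ≥0 × ℝ≥0 → ℝ≥0∞)
    (u : ℝ≥0 × ℝ≥0) : ℝ≥0∞ :=
  ⨅ j, valueIter κ k G j u

variable {k G : ℝ≥0 × ℝ≥0 → ℝ≥0∞}

theorem measurable_valueIter [SFinite κ] (hk : Measurable k) (hG : Measurable G) (j : ℕ) :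
    Measurable (valueIter κ k G j) := by
  induction j with
  | zero => exact hG
  | succ j ih => exact hG.min (hk.add (measurable_transition ih))

theorem measurable_value [SFinite κ] (hk : Measurable k) (hG : Measurable G) :
    Measurable (value κ k G) :=
  Measurable.iInf fun j => measurable_valueIter hk hG j

theorem valueIter_antitone : Antitone (valueIter κ k G) := by
  refine antitone_nat_of_succ_le fun j => ?_
  induction j with
  | zero => exact fun u => min_le_left _ _
  | succ j ih => exact fun u => min_le_min le_rfl (add_le_add le_rfl (transition_mono ih u))

/-- The finite-horizon values decrease, so passing to the limit under the integral needs a finite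
integral at horizon zero; that is the role of `hfin`. -/
theorem value_eq_min [SFinite κ] (hk : Measurable k) (hG : Measurable G)
    (hfin : ∀ u, transition κ G u ≠ ∞) (u : ℝ≥0 × ℝ≥0) :
    value κ k G u = min (G u) (k u + transition κ (value κ k G) u) := by
  have h1 : transition κ (value κ k G) u = ⨅ j, transition κ (valueIter κ k G j) u :=
    lintegral_iInf (fun j => (measurable_valueIter hk hG j).comp (by fun_prop))
      (fun i j hij w => valueIter_antitone hij (u * w)) (hfin u)
  rw [h1, ENNReal.add_iInf]
  refine le_antisymm (le_min (iInf_le _ 0) (le_iInf fun j => ?_)) (le_iInf fun j => ?_)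
  · exact (iInf_le _ (j + 1)).trans (min_le_right _ _)
  · refine le_trans ?_ (valueIter_antitone (Nat.le_succ j) u)
    exact min_le_min le_rfl (iInf_le _ j)

theorem transition_monotone {H : ℝ≥0 × ℝ≥0 → ℝ≥0∞} (hH : Monotone H) :
    Monotone (transition κ H) :=
  fun _ _ huv => lintegral_mono fun _ => hH (mul_le_mul_left huv _)

theorem value_monotone (hk : Monotone k) (hG : Monotone G) : Monotone (value κ k G) := by
  have : ∀ j, Monotone (valueIter κ k G j) := by
    intro j
    induction j with
    | zero => exact hG
    | succ j ih => exact hG.min (hk.add (transition_monotone ih))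
  exact fun u v huv => iInf_mono fun j => this j huv

/-- Positive homogeneity of degree one. -/
def PosHomogeneous (H : ℝ≥0 × ℝ≥0 → ℝ≥0∞) : Prop :=
  ∀ (t : ℝ≥0) (u : ℝ≥0 × ℝ≥0), H (t • u) = t * H u

theorem PosHomogeneous.transition {H : ℝ≥0 × ℝ≥0 → ℝ≥0∞} (hH : PosHomogeneous H) :
    PosHomogeneous (transition κ H) := by
  intro t u
  simp only [GroupSequential.transition, smul_mul_assoc, hH t]
  exact lintegral_const_mul' _ _ ENNReal.coe_ne_top

theorem PosHomogeneous.min {H H' : ℝ≥0 × ℝ≥0 → ℝ≥0∞} (hH : PosHomogeneous H)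
    (hH' : PosHomogeneous H') : PosHomogeneous fun u => min (H u) (H' u) := by
  intro t u
  simp only [hH t, hH' t]
  exact ((mul_right_mono (a := (t : ℝ≥0∞))).map_min).symm

theorem PosHomogeneous.add {H H' : ℝ≥0 × ℝ≥0 → ℝ≥0∞} (hH : PosHomogeneous H)
    (hH' : PosHomogeneous H') : PosHomogeneous fun u => H u + H' u := by
  intro t u
  simp only [hH t, hH' t, mul_add]

theorem posHomogeneous_value (hk : PosHomogeneous k) (hG : PosHomogeneous G) :
    PosHomogeneous (value κ k G) := by
  have h : ∀ j, PosHomogeneous (valueIter κ k G j) := by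
    intro j
    induction j with
    | zero => exact hG
    | succ j ih => exact hG.min (hk.add ih.transition)
  intro t u
  simp only [value, h _ t]
  rcases eq_or_ne t 0 with rfl | ht
  · simp
  · exact (ENNReal.mul_iInf_of_ne (by simpa using ht) ENNReal.coe_ne_top).symm

end GroupSequential

/-! ### Error weights that make prescribed thresholds optimal. -/

namespace GroupSequential

variable {κ : Measure (ℝ≥0 × ℝ≥0)}

theorem transition_indicator_const_mul (S : Set (ℝ≥0 × ℝ≥0)) (b : ℝ≥0)
    (H : ℝ≥0 × ℝ≥0 → ℝ≥0∞) :
    transition κ (S.indicator fun v => b * H v)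
      = fun u => b * transition κ (S.indicator H) u := by
  ext u
  rw [← transition_const_mul]
  congr 1
  ext v
  by_cases hv : v ∈ S <;> simp [hv]

/-- For all `A < B` there are weights `l₀`, `l₁` of the two errors such that continuing strictly
between `A` and `B` is optimal in the stopping problem with running cost `b₀ u₀ + b₁ u₁`. The
function `R` is the value of that problem. -/
theorem exists_value [SFinite κ] (hκ : IsLikelihoodStep κ) {A B : ℝ≥0} (hA : 0 < A) (hAB : A < B)
    (b₀ b₁ : ℝ≥0) (hb : 0 < b₀ + b₁) :
    ∃ l₀ l₁ : ℝ≥0, 0 < l₀ ∧ 0 < l₁ ∧ ∃ R : ℝ≥0 × ℝ≥0 → ℝ≥0∞, Measurable R ∧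
      (∀ u, R u ≤ l₀ * u.1) ∧ (∀ u, R u ≤ l₁ * u.2) ∧
      (∀ u, R u ≤ (b₀ * u.1 + b₁ * u.2) + transition κ R u) ∧
      (∀ u, B * u.1 ≤ u.2 → l₀ * u.1 ≤ R u) ∧ (∀ u, u.2 ≤ A * u.1 → l₁ * u.2 ≤ R u) ∧
      (∀ u, A * u.1 ≤ u.2 → u.2 ≤ B * u.1 →
        (b₀ * u.1 + b₁ * u.2) + transition κ R u ≤ R u) := by
  have hB : 0 < B := hA.trans hAB
  obtain ⟨aA, βA, γ, hβγ, hBa, hγ, haA, hβA⟩ := exit_from_low (B := B) hκ hA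
  obtain ⟨aB, βB, a', haa', hβa', ha', haB, hβB⟩ := exit_from_high hκ hA hAB
  have hdet := mul_lt_mul_of_ratio_bounds hAB hγ ha' hBa hβa'
  obtain ⟨k, hkdef⟩ : ∃ k : ℝ≥0 × ℝ≥0 → ℝ≥0∞, k = fun u => (b₀ * u.1 + b₁ * u.2 : ℝ≥0∞) :=
    ⟨_, rfl⟩
  have hku : ∀ u, k u = ((b₀ * u.1 + b₁ * u.2 : ℝ≥0) : ℝ≥0∞) := fun u => by
    rw [hkdef]; push_cast; rfl
  have hk : Measurable k := by rw [hkdef]; fun_prop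
  have hkmid : ∀ u ∈ midRegion A B, k u ≤ ((b₀ + b₁ * B : ℝ≥0) : ℝ≥0∞) * u.1 := by
    intro u hu
    have : b₀ * u.1 + b₁ * u.2 ≤ (b₀ + b₁ * B) * u.1 := by
      rw [add_mul, mul_assoc]
      gcongr
      exact hu.2.le
    rw [hku]
    exact_mod_cast this
  have hkpos : ∀ t : ℝ≥0, 0 < t → 0 < k (1, t) := by
    intro t ht
    have : 0 < b₀ * 1 + b₁ * t := by
      rcases eq_or_ne b₀ 0 with h | h
      · rw [h, zero_add] at hb
        positivity
      · positivity
    rw [hku]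
    exact_mod_cast this
  have hkfin : ∀ u, k u ≠ ∞ := fun u => by
    rw [hku]; exact ENNReal.coe_ne_top
  have hfst := potential_fst_ne_top hκ hA B
  obtain ⟨nA, hnA⟩ : ∃ n : ℝ≥0, potential κ (midRegion A B) k (1, A) = n :=
    ⟨_, (ENNReal.coe_toNNReal
      (potential_ne_top_of_le_on hkmid (hfst (1, A)) (hkfin _))).symm⟩
  obtain ⟨nB, hnB⟩ : ∃ n : ℝ≥0, potential κ (midRegion A B) k (1, B) = n :=
    ⟨_, (ENNReal.coe_toNNReal
      (potential_ne_top_of_le_on hkmid (hfst (1, B)) (hkfin _))).symm⟩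
  have hnA0 : 0 < nA := by
    have := (hkpos A hA).trans_le (le_potential (κ := κ) (C := midRegion A B) (1, A))
    rw [hnA] at this
    exact_mod_cast this
  have hnB0 : 0 < nB := by
    have := (hkpos B hB).trans_le (le_potential (κ := κ) (C := midRegion A B) (1, B))
    rw [hnB] at this
    exact_mod_cast this
  -- These equations say that the A-B rule, with a forced first group, has risk l₁A from (1, A) and
  -- l₀ from (1, B), which are the losses of accepting and of rejecting there; see `hVA` and `hVB`.
  obtain ⟨l₁, l₀, hl₁, hl₀, hsysA, hsysB⟩ := exists_multipliers hγ ha' hdet hnA0 hnB0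
  have hmid := measurableSet_midRegion A B
  have hmlow := measurableSet_lowRegion A
  have hmhigh := measurableSet_highRegion A B
  have hpot : ∀ (s : ℝ≥0 × ℝ≥0 → ℝ≥0∞) (x y : ℝ≥0) (u : ℝ≥0 × ℝ≥0), Measurable s →
      potential κ (midRegion A B) (fun u => s u
        + (transition κ ((lowRegion A).indicator fun v => x * (v.2 : ℝ≥0∞)) u
          + transition κ ((highRegion A B).indicator fun v => y * (v.1 : ℝ≥0∞)) u)) u
      = potential κ (midRegion A B) s u
        + (x * potential κ (midRegion A B)
            (transition κ ((lowRegion A).indicator fun v => (v.2 : ℝ≥0∞))) u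
          + y * potential κ (midRegion A B)
            (transition κ ((highRegion A B).indicator fun v => (v.1 : ℝ≥0∞))) u) := by
    intro s x y u hs
    rw [potential_add hmid hs, potential_add hmid, transition_indicator_const_mul,
      transition_indicator_const_mul, potential_const_mul, potential_const_mul]
    exact measurable_transition (Measurable.indicator (by fun_prop) hmlow)
  obtain ⟨r, hrdef⟩ : ∃ r : ℝ≥0 × ℝ≥0 → ℝ≥0∞, r = fun u => k u
      + (transition κ ((lowRegion A).indicator fun v => l₁ * (v.2 : ℝ≥0∞)) u
        + transition κ ((highRegion A B).indicator fun v => l₀ * (v.1 : ℝ≥0∞)) u) := ⟨_, rfl⟩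
  have hr : Measurable r := by
    rw [hrdef]
    exact hk.add ((measurable_transition (Measurable.indicator (by fun_prop) hmlow)).add
      (measurable_transition (Measurable.indicator (by fun_prop) hmhigh)))
  have hVA : potential κ (midRegion A B) r (1, A) = l₁ * A := by
    rw [hrdef, hpot k _ _ _ hk, hnA, haA, hβA]
    have : nA + (l₁ * βA + l₀ * aA) = l₁ * A := by rw [← hβγ, mul_add, hsysA]; ring
    exact_mod_cast this
  have hVB : potential κ (midRegion A B) r (1, B) = l₀ := by
    rw [hrdef, hpot k _ _ _ hk, hnB, haB, hβB]
    have : nB + (l₁ * βB + l₀ * aB) = l₀ := by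
      rw [← add_assoc, ← hsysB, ← mul_add, add_comm, haa', mul_one]
    exact_mod_cast this
  obtain ⟨G, hGdef⟩ : ∃ G : ℝ≥0 × ℝ≥0 → ℝ≥0∞,
      G = fun u => min (l₀ * u.1 : ℝ≥0∞) (l₁ * u.2 : ℝ≥0∞) := ⟨_, rfl⟩
  have hG : Measurable G := by rw [hGdef]; fun_prop
  have hG0 : ∀ u, G u ≤ l₀ * u.1 := fun u => by rw [hGdef]; exact min_le_left _ _
  have hG1 : ∀ u, G u ≤ l₁ * u.2 := fun u => by rw [hGdef]; exact min_le_right _ _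
  have hTl₀ : ∀ u, transition κ (fun u => l₀ * (u.1 : ℝ≥0∞)) u = l₀ * u.1 := fun u => by
    rw [transition_const_mul, transition_fst hκ]
  have hRmin := value_eq_min hk hG (κ := κ) fun u => ne_top_of_le_ne_top
    (ENNReal.mul_ne_top ENNReal.coe_ne_top ENNReal.coe_ne_top)
    ((transition_mono hG0 u).trans_eq (hTl₀ u))
  have hRm : Measurable (value κ k G) := measurable_value hk hG
  have hkmono : Monotone k := fun u v huv => by
    rw [hkdef]
    have h1 := huv.1
    have h2 := huv.2
    dsimp only
    gcongr
  have hRmono : Monotone (value κ k G) := by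
    refine value_monotone hkmono fun u v huv => ?_
    rw [hGdef]
    have h1 := huv.1
    have h2 := huv.2
    dsimp only
    gcongr
  have hkhom : PosHomogeneous k := fun t u => by
    rw [hkdef]; simp only [Prod.smul_fst, Prod.smul_snd, smul_eq_mul]; push_cast; ring
  have hRhom : PosHomogeneous (value κ k G) := by
    refine posHomogeneous_value hkhom ?_
    rw [hGdef]
    refine PosHomogeneous.min (fun t u => ?_) (fun t u => ?_) <;>
    · simp only [Prod.smul_fst, Prod.smul_snd, smul_eq_mul]; push_cast; ring
  -- From here on R is known only through the Bellman equation, measurability, monotonicity and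
  -- homogeneity.
  generalize value κ k G = R at *
  have hR0 : ∀ u, R u ≤ l₀ * u.1 := fun u => (hRmin u).le.trans ((min_le_left _ _).trans (hG0 u))
  have hR1 : ∀ u, R u ≤ l₁ * u.2 := fun u => (hRmin u).le.trans ((min_le_left _ _).trans (hG1 u))
  obtain ⟨W, hWdef⟩ : ∃ W : ℝ≥0 × ℝ≥0 → ℝ≥0∞, W = fun u => k u + transition κ R u := ⟨_, rfl⟩
  have hWu : ∀ u, W u = k u + transition κ R u := fun u => by rw [hWdef]
  have hRW : ∀ u, R u ≤ W u := fun u => by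
    rw [hWu]; exact (hRmin u).le.trans (min_le_right _ _)
  have hWmono : Monotone W := by rw [hWdef]; exact hkmono.add (transition_monotone hRmono)
  have hWhom : PosHomogeneous W := by rw [hWdef]; exact hkhom.add hRhom.transition
  -- `r` charges the stopping losses on leaving the middle region. Since R is below these losses, W
  -- is a subsolution of the equation whose solution is the risk of the A-B rule.
  have hWr : ∀ u, W u ≤ r u + killed κ (midRegion A B) W u := by
    intro u
    rw [hWu, transition_eq_add_killed A B hRm u, ← add_assoc, hrdef]
    dsimp only
    gcongr
    · refine transition_mono (fun v => ?_) u
      exact Set.indicator_le_indicator (hR1 v)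
    · refine transition_mono (fun v => ?_) u
      exact Set.indicator_le_indicator (hR0 v)
    · exact killed_mono hRW u
  have hWmid : ∀ u ∈ midRegion A B, W u ≤ ((b₀ + b₁ * B + l₀ : ℝ≥0) : ℝ≥0∞) * u.1 := by
    intro u hu
    rw [hWu, ENNReal.coe_add, add_mul]
    exact add_le_add (hkmid u hu) ((transition_mono hR0 u).trans_eq (hTl₀ u))
  have hWV : ∀ u, W u ≤ potential κ (midRegion A B) r u := fun u =>
    le_potential_of_le_add_killed hmid hr hWr hWmid (hfst u)
  have hWA : W (1, A) ≤ l₁ * A := (hWV _).trans hVA.le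
  have hWB : W (1, B) ≤ l₀ := (hWV _).trans hVB.le
  have hscaleB : ∀ t : ℝ≥0, ((t, B * t) : ℝ≥0 × ℝ≥0) = t • ((1, B) : ℝ≥0 × ℝ≥0) := fun t => by
    simp [mul_comm]
  have hscaleA : ∀ t : ℝ≥0, ((t / A, t) : ℝ≥0 × ℝ≥0) = (t / A) • ((1, A) : ℝ≥0 × ℝ≥0) :=
    fun t => by simp [div_mul_cancel₀ _ hA.ne']
  -- A point of the cone is dominated by the point of the upper ray with the same first coordinate,
  -- and by the point of the lower ray with the same second coordinate; W is monotone and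
  -- homogeneous, so the two ray values suffice.
  have hWcone : ∀ u, A * u.1 ≤ u.2 → u.2 ≤ B * u.1 → W u ≤ R u := by
    intro u hu hu'
    rw [hRmin u, hGdef, ← hWu u]
    refine le_min (le_min ?_ ?_) le_rfl
    · calc W u ≤ W (u.1, B * u.1) := hWmono ⟨le_rfl, hu'⟩
        _ = u.1 * W (1, B) := by rw [hscaleB, hWhom]
        _ ≤ u.1 * l₀ := by gcongr
        _ = l₀ * u.1 := mul_comm _ _
    · calc W u ≤ W (u.2 / A, u.2) := hWmono ⟨(le_div_iff₀' hA).2 hu, le_rfl⟩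
        _ = (u.2 / A : ℝ≥0) * W (1, A) := by rw [hscaleA, hWhom]
        _ ≤ (u.2 / A : ℝ≥0) * (l₁ * A) := by gcongr
        _ = l₁ * u.2 := by
          have : u.2 / A * (l₁ * A) = l₁ * u.2 := by field_simp
          exact_mod_cast this
  have hRA : R (1, A) = W (1, A) :=
    le_antisymm (hRW _) (hWcone _ (by simp) (by simpa using hAB.le))
  have hRB : R (1, B) = W (1, B) :=
    le_antisymm (hRW _) (hWcone _ (by simpa using hAB.le) (by simp))
  obtain ⟨wA, hwA⟩ : ∃ w : ℝ≥0, W (1, A) = w :=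
    ⟨_, (ENNReal.coe_toNNReal (ne_top_of_le_ne_top (by finiteness) hWA)).symm⟩
  obtain ⟨wB, hwB⟩ : ∃ w : ℝ≥0, W (1, B) = w :=
    ⟨_, (ENNReal.coe_toNNReal (ne_top_of_le_ne_top (by finiteness) hWB)).symm⟩
  rw [hwA] at hWA hRA
  rw [hwB] at hWB hRB
  -- The slacks measure by how much stopping exceeds the value on the two rays. By monotonicity and
  -- homogeneity they bound the excess in the outer regions too, and the rest of the proof shows
  -- that both are zero.
  obtain ⟨δB, hδB⟩ : ∃ δ : ℝ≥0, l₀ = wB + δ := exists_add_of_le (by exact_mod_cast hWB)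
  obtain ⟨δA, hδA⟩ : ∃ δ : ℝ≥0, l₁ * A = wA + δ * A := by
    obtain ⟨δ, hδ⟩ : ∃ δ : ℝ≥0, l₁ * A = wA + δ := exists_add_of_le (by exact_mod_cast hWA)
    exact ⟨δ / A, by rwa [div_mul_cancel₀ _ hA.ne']⟩
  have hhigh : ∀ u : ℝ≥0 × ℝ≥0, B * u.1 ≤ u.2 → l₀ * (u.1 : ℝ≥0∞) ≤ R u + δB * u.1 := by
    intro u hu
    calc (l₀ * u.1 : ℝ≥0∞) = u.1 * wB + δB * u.1 := by rw [hδB]; push_cast; ring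
      _ = R (u.1, B * u.1) + δB * u.1 := by rw [hscaleB, hRhom, hRB]
      _ ≤ R u + δB * u.1 := by
          gcongr
          exact hRmono ⟨le_rfl, hu⟩
  have hlow : ∀ u : ℝ≥0 × ℝ≥0, u.2 ≤ A * u.1 → l₁ * (u.2 : ℝ≥0∞) ≤ R u + δA * u.2 := by
    intro u hu
    calc (l₁ * u.2 : ℝ≥0∞) = (u.2 / A : ℝ≥0) * wA + δA * u.2 := by
          have : l₁ * u.2 = u.2 / A * wA + δA * u.2 := by
            calc l₁ * u.2 = u.2 / A * (l₁ * A) := by field_simp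
              _ = _ := by rw [hδA]; field_simp
          exact_mod_cast this
      _ = R (u.2 / A, u.2) + δA * u.2 := by rw [hscaleA, hRhom, hRA]
      _ ≤ R u + δA * u.2 := by
          gcongr
          exact hRmono ⟨(div_le_iff₀' hA).2 hu, le_rfl⟩
  obtain ⟨s, hsdef⟩ : ∃ s : ℝ≥0 × ℝ≥0 → ℝ≥0∞, s = fun u => k u
      + (transition κ ((lowRegion A).indicator R) u
        + transition κ ((highRegion A B).indicator R) u) := ⟨_, rfl⟩
  have hs : Measurable s := by
    rw [hsdef]
    exact hk.add ((measurable_transition (hRm.indicator hmlow)).add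
      (measurable_transition (hRm.indicator hmhigh)))
  -- With R itself charged on exit, W is a supersolution; hence the A-B rule loses against W at most
  -- the slacks collected at exit, which is `hVW`.
  have hsW : ∀ u, s u + killed κ (midRegion A B) W u ≤ W u := by
    intro u
    rw [hWu, transition_eq_add_killed A B hRm u, ← add_assoc, hsdef]
    dsimp only
    gcongr
    exact killed_mono_on (fun v hv => hWcone v hv.1.le hv.2.le) u
  have hrs : ∀ u, r u ≤ s u
      + (transition κ ((lowRegion A).indicator fun v => δA * (v.2 : ℝ≥0∞)) u
        + transition κ ((highRegion A B).indicator fun v => δB * (v.1 : ℝ≥0∞)) u) := by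
    intro u
    rw [hrdef, hsdef, add_assoc, add_add_add_comm, ← transition_add (hRm.indicator hmlow),
      ← transition_add (hRm.indicator hmhigh)]
    refine add_le_add le_rfl (add_le_add (transition_mono (fun v => ?_) u)
      (transition_mono (fun v => ?_) u))
    · by_cases hv : v ∈ lowRegion A
      · simpa [hv] using hlow v hv
      · simp [hv]
    · by_cases hv : v ∈ highRegion A B
      · simpa [hv] using hhigh v hv.2
      · simp [hv]
  have hVW : ∀ u, potential κ (midRegion A B) r u ≤ W u
      + (δA * potential κ (midRegion A B)
          (transition κ ((lowRegion A).indicator fun v => (v.2 : ℝ≥0∞))) u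
        + δB * potential κ (midRegion A B)
          (transition κ ((highRegion A B).indicator fun v => (v.1 : ℝ≥0∞))) u) := by
    intro u
    refine (potential_mono hrs u).trans ?_
    rw [hpot s _ _ _ hs]
    gcongr
    exact potential_le hmid hs hsW u
  -- On the two rays the left side of `hVW` exceeds W by exactly the slack. Cancelling leaves δA·γ ≤
  -- δB·aA and δB·a' ≤ δA·βB, the homogeneous form of the multiplier system.
  have hδ : δA = 0 ∧ δB = 0 := by
    have h1 := hVW (1, A)
    rw [hVA, hwA, hβA, haA] at h1
    have h2 := hVW (1, B)
    rw [hVB, hwB, hβB, haB] at h2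
    have h1' : wA + δA * A ≤ wA + (δA * βA + δB * aA) := by
      rw [← hδA]; exact_mod_cast h1
    have h2' : wB + δB ≤ wB + (δA * βB + δB * aB) := by
      rw [← hδB]; exact_mod_cast h2
    refine eq_zero_of_mul_le_mul ha' hdet ?_ ?_
    · have := le_of_add_le_add_left h1'
      rw [← hβγ, mul_add] at this
      exact le_of_add_le_add_left this
    · have := le_of_add_le_add_left h2'
      rw [add_comm] at this
      refine le_of_add_le_add_left (a := δB * aB) (le_trans (le_of_eq ?_) this)
      rw [← mul_add, haa', mul_one]
  refine ⟨l₀, l₁, hl₀, hl₁, R, hRm, hR0, hR1, fun u => ?_, fun u hu => ?_, fun u hu => ?_,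
    fun u hu hu' => ?_⟩
  · simpa only [hWu, hkdef] using hRW u
  · simpa [hδ.2] using hhigh u hu
  · simpa [hδ.1] using hlow u hu
  · simpa only [hWu, hkdef] using hWcone u hu hu'

end GroupSequential

/-! ### Fubini over groups: from the sampling model to the walk. -/

namespace GroupSequential

section Fubini

theorem measurable_snoc {k : ℕ} {α : Fin (k + 1) → Type*} [∀ i, MeasurableSpace (α i)] :
    Measurable fun q : (∀ i : Fin k, α i.castSucc) × α (Fin.last k) =>
      (Fin.snoc q.1 q.2 : ∀ i, α i) := by
  refine measurable_pi_iff.2 fun i => ?_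
  induction i using Fin.lastCases with
  | last => simpa using measurable_snd
  | cast i =>
    simp only [Fin.snoc_castSucc]
    exact (measurable_pi_apply i).comp measurable_fst

theorem map_snoc_prod_pi {k : ℕ} {α : Fin (k + 1) → Type*} [∀ i, MeasurableSpace (α i)]
    (ν : ∀ i, Measure (α i)) [∀ i, SigmaFinite (ν i)] :
    ((Measure.pi fun i : Fin k => ν i.castSucc).prod (ν (Fin.last k))).map
      (fun q => (Fin.snoc q.1 q.2 : ∀ i, α i)) = Measure.pi ν := by
  refine (Measure.pi_eq fun s hs => ?_).symm
  rw [Measure.map_apply measurable_snoc (MeasurableSet.univ_pi hs), Fin.prod_univ_castSucc,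
    ← Measure.pi_pi, ← Measure.prod_prod]
  congr 1
  ext q
  simp only [Set.mem_preimage, Set.mem_pi, Set.mem_univ, true_implies, Set.mem_prod]
  refine ⟨fun h => ⟨fun i => by simpa using h i.castSucc, by simpa using h (Fin.last k)⟩,
    fun h i => ?_⟩
  induction i using Fin.lastCases with
  | last => simpa using h.2
  | cast i => simpa using h.1 i

theorem lintegral_pi_succ {k : ℕ} {α : Fin (k + 1) → Type*} [∀ i, MeasurableSpace (α i)]
    (ν : ∀ i, Measure (α i)) [∀ i, SigmaFinite (ν i)]
    {F : (∀ i : Fin k, α i.castSucc) × α (Fin.last k) → ℝ≥0∞} (hF : Measurable F) :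
    ∫⁻ x, F (fun i => x i.castSucc, x (Fin.last k)) ∂Measure.pi ν
      = ∫⁻ x, ∫⁻ y, F (x, y) ∂ν (Fin.last k) ∂Measure.pi fun i : Fin k => ν i.castSucc := by
  have h1 : Measurable fun x : ∀ i, α i => F (fun i : Fin k => x i.castSucc, x (Fin.last k)) :=
    hF.comp (by fun_prop)
  rw [← map_snoc_prod_pi ν, lintegral_map h1 measurable_snoc]
  simp only [Fin.snoc_castSucc, Fin.snoc_last]
  exact lintegral_prod _ hF.aemeasurable

theorem lintegral_prod_pi {α : Type*} [MeasurableSpace α] (μ : Measure α) [SigmaFinite μ]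
    {g : α → ℝ≥0∞} (hg : Measurable g) (m : ℕ) :
    ∫⁻ y, ∏ j, g (y j) ∂(Measure.pi fun _ : Fin m => μ) = (∫⁻ a, g a ∂μ) ^ m := by
  induction m with
  | zero => simp
  | succ m ih =>
    simp only [Fin.prod_univ_castSucc]
    have hF : Measurable fun q : (Fin m → α) × α => (∏ j, g (q.1 j)) * g q.2 := by fun_prop
    rw [lintegral_pi_succ (fun _ : Fin (m + 1) => μ) hF]
    simp only [lintegral_const_mul _ hg]
    rw [lintegral_mul_const _ (by fun_prop), ih, pow_succ]

end Fubini

variable {𝔛 : Type*} {𝒢 : Set ℕ}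

/-- The two joint densities of a single group of size `m`. -/
noncomputable def groupDensities (f : Fin 2 → 𝔛 → ℝ≥0) (m : ℕ) (y : Fin m → 𝔛) : ℝ≥0 × ℝ≥0 :=
  (∏ j, f 0 (y j), ∏ j, f 1 (y j))

/-- The two joint densities of the observations in the first groups. -/
noncomputable def densities (f : Fin 2 → 𝔛 → ℝ≥0) {k : ℕ} (n : Fin k → 𝒢) (x : Sample 𝔛 n) :
    ℝ≥0 × ℝ≥0 :=
  (jointDensity (f 0) n x, jointDensity (f 1) n x)

theorem densities_succ (f : Fin 2 → 𝔛 → ℝ≥0) {k : ℕ} (n : Fin (k + 1) → 𝒢) (x : Sample 𝔛 n) :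
    densities f n x = densities f (fun i : Fin k => n i.castSucc) (fun i => x i.castSucc)
      * groupDensities f (n (Fin.last k)) (x (Fin.last k)) := by
  simp only [densities, groupDensities, jointDensity, Fin.prod_univ_castSucc, Prod.mk_mul_mk]

variable [MeasurableSpace 𝔛]

theorem measurable_groupDensities {f : Fin 2 → 𝔛 → ℝ≥0} (hf : ∀ i, Measurable (f i)) (m : ℕ) :
    Measurable (groupDensities f m) := by
  have := hf 0
  have := hf 1
  unfold groupDensities
  fun_prop

theorem measurable_jointDensity {g : 𝔛 → ℝ≥0} (hg : Measurable g) {k : ℕ}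
    (n : Fin k → 𝒢) : Measurable (jointDensity g n) := by
  unfold jointDensity
  refine Finset.measurable_prod _ fun i _ => Finset.measurable_prod _ fun j _ => ?_
  exact hg.comp ((measurable_pi_apply j).comp (measurable_pi_apply i))

theorem measurable_densities {f : Fin 2 → 𝔛 → ℝ≥0} (hf : ∀ i, Measurable (f i)) {k : ℕ}
    (n : Fin k → 𝒢) : Measurable (densities f n) :=
  (measurable_jointDensity (hf 0) n).prodMk (measurable_jointDensity (hf 1) n)

/-- The image of the reference measures under the densities of one group, mixed over the sizes of
the group with the weights `q`. -/
noncomputable def stepMeasure (μ : Measure 𝔛) (f : Fin 2 → 𝔛 → ℝ≥0) (q : 𝒢 → ℝ≥0∞) :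
    Measure (ℝ≥0 × ℝ≥0) :=
  Measure.sum fun m : 𝒢 =>
    q m • (Measure.pi fun _ : Fin (m : ℕ) => μ).map (groupDensities f m)

variable {μ : Measure 𝔛} {f : Fin 2 → 𝔛 → ℝ≥0} {p : PMF 𝒢}
  {q : 𝒢 → ℝ≥0∞}

theorem lintegral_stepMeasure (hf : ∀ i, Measurable (f i)) {H : ℝ≥0 × ℝ≥0 → ℝ≥0∞}
    (hH : Measurable H) :
    ∫⁻ w, H w ∂stepMeasure μ f q = ∑' m : 𝒢, q m *
      ∫⁻ y, H (groupDensities f m y) ∂(Measure.pi fun _ : Fin (m : ℕ) => μ) := by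
  rw [stepMeasure, lintegral_sum_measure]
  congr 1
  ext m
  rw [lintegral_smul_measure, lintegral_map hH (measurable_groupDensities hf m), smul_eq_mul]

theorem transition_stepMeasure (hf : ∀ i, Measurable (f i)) {H : ℝ≥0 × ℝ≥0 → ℝ≥0∞}
    (hH : Measurable H) (u : ℝ≥0 × ℝ≥0) :
    transition (stepMeasure μ f q) H u = ∑' m : 𝒢, q m *
      ∫⁻ y, H (u * groupDensities f m y) ∂(Measure.pi fun _ : Fin (m : ℕ) => μ) :=
  lintegral_stepMeasure hf (H := fun w => H (u * w)) (hH.comp (by fun_prop))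

/-- The sum over the sizes `n` of `k` groups of `p(n) ∫ g_n dμ^n`. -/
noncomputable def levelSum (μ : Measure 𝔛) (p : PMF 𝒢) (k : ℕ)
    (g : (n : Fin k → 𝒢) → Sample 𝔛 n → ℝ≥0∞) : ℝ≥0∞ :=
  ∑' n : Fin k → 𝒢, sizeProb p n * ∫⁻ x, g n x ∂sampleMeasure μ n

theorem levelSum_zero (g : (n : Fin 0 → 𝒢) → Sample 𝔛 n → ℝ≥0∞) {a : ℝ≥0∞}
    (hg : ∀ n x, g n x = a) : levelSum μ p 0 g = a := by
  simp only [levelSum, hg]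
  simp [sizeProb, sampleMeasure, tsum_fintype]

/-- AM-GM is strict exactly where the densities differ, a set of positive measure, and the
arithmetic mean integrates to one. -/
theorem lintegral_sqrt_mul_lt_one (hf : ∀ i, Measurable (f i))
    (hf_one : ∀ i, ∫⁻ x, (f i x : ℝ≥0∞) ∂μ = 1) (hf_ne : 0 < μ {x | f 0 x ≠ f 1 x}) :
    ∫⁻ x, (NNReal.sqrt (f 0 x * f 1 x) : ℝ≥0∞) ∂μ < 1 := by
  have hm0 := hf 0
  have hm1 := hf 1
  have hmean : ∫⁻ x, ((2⁻¹ : ℝ≥0) : ℝ≥0∞) * ((f 0 x : ℝ≥0∞) + f 1 x) ∂μ = 1 := by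
    rw [lintegral_const_mul' _ _ ENNReal.coe_ne_top, lintegral_add_left (by fun_prop), hf_one,
      hf_one, one_add_one_eq_two, ENNReal.coe_inv two_ne_zero]
    exact ENNReal.inv_mul_cancel (by simp) (by simp)
  have key : ∀ a b : ℝ≥0, a ≠ b → NNReal.sqrt (a * b) < 2⁻¹ * (a + b) := by
    intro a b hab
    rw [← not_le, NNReal.le_sqrt_iff_sq_le, not_le, ← NNReal.coe_lt_coe]
    have h : (0 : ℝ) < ((a : ℝ) - b) ^ 2 := by
      have : (a : ℝ) - b ≠ 0 := sub_ne_zero.2 (by exact_mod_cast hab)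
      positivity
    push_cast
    nlinarith
  have key' : ∀ a b : ℝ≥0, NNReal.sqrt (a * b) ≤ 2⁻¹ * (a + b) := by
    intro a b
    rcases eq_or_ne a b with rfl | hab
    · rw [NNReal.sqrt_mul_self, ← two_mul, inv_mul_cancel_left₀ two_ne_zero]
    · exact (key a b hab).le
  have hle : ∀ x, (NNReal.sqrt (f 0 x * f 1 x) : ℝ≥0∞)
      ≤ ((2⁻¹ : ℝ≥0) : ℝ≥0∞) * ((f 0 x : ℝ≥0∞) + f 1 x) := fun x => by
    exact_mod_cast key' (f 0 x) (f 1 x)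
  rw [← hmean]
  refine lintegral_strict_mono_of_ae_le_of_ae_lt_on (by fun_prop)
    (ne_top_of_le_ne_top ENNReal.one_ne_top ((lintegral_mono hle).trans hmean.le))
    (Filter.Eventually.of_forall hle) hf_ne.ne' (Filter.Eventually.of_forall fun x hx => ?_)
  exact_mod_cast key _ _ hx

variable [SigmaFinite μ]

instance : SFinite (stepMeasure μ f q) := by
  unfold stepMeasure; infer_instance

theorem lintegral_stepMeasure_fst (hf : ∀ i, Measurable (f i))
    (hf_one : ∀ i, ∫⁻ x, (f i x : ℝ≥0∞) ∂μ = 1) :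
    ∫⁻ w, (w.1 : ℝ≥0∞) ∂stepMeasure μ f q = ∑' m, q m := by
  have h0 := hf 0
  rw [lintegral_stepMeasure hf (by fun_prop)]
  congr 1
  ext m
  simp only [groupDensities, ENNReal.ofNNReal_finsetProd]
  rw [lintegral_prod_pi μ (g := fun a => (f 0 a : ℝ≥0∞)) (by fun_prop), hf_one, one_pow, mul_one]

theorem lintegral_stepMeasure_snd (hf : ∀ i, Measurable (f i))
    (hf_one : ∀ i, ∫⁻ x, (f i x : ℝ≥0∞) ∂μ = 1) :
    ∫⁻ w, (w.2 : ℝ≥0∞) ∂stepMeasure μ f q = ∑' m, q m := by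
  have h1 := hf 1
  rw [lintegral_stepMeasure hf (by fun_prop)]
  congr 1
  ext m
  simp only [groupDensities, ENNReal.ofNNReal_finsetProd]
  rw [lintegral_prod_pi μ (g := fun a => (f 1 a : ℝ≥0∞)) (by fun_prop), hf_one, one_pow, mul_one]

/-- A group of size m contributes ρ^m, where ρ < 1 is the affinity of a single observation. Empty
groups contribute 1, so a nonempty group of positive probability is needed for strictness. -/
theorem isLikelihoodStep_stepMeasure (hf : ∀ i, Measurable (f i))
    (hf_one : ∀ i, ∫⁻ x, (f i x : ℝ≥0∞) ∂μ = 1) (hf_ne : 0 < μ {x | f 0 x ≠ f 1 x})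
    (hp : ∃ m : 𝒢, 0 < (m : ℕ) ∧ 0 < p m) : IsLikelihoodStep (stepMeasure μ f p) where
  lintegral_fst := by rw [lintegral_stepMeasure_fst hf hf_one, p.tsum_coe]
  lintegral_snd := by rw [lintegral_stepMeasure_snd hf hf_one, p.tsum_coe]
  lintegral_geomMean_lt := by
    have hθ := lintegral_sqrt_mul_lt_one hf hf_one hf_ne
    have h0 := hf 0
    have h1 := hf 1
    have hg : ∀ m : ℕ, ∫⁻ y, geomMean (groupDensities f m y) ∂(Measure.pi fun _ : Fin m => μ)
        = (∫⁻ x, (NNReal.sqrt (f 0 x * f 1 x) : ℝ≥0∞) ∂μ) ^ m := by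
      intro m
      rw [← lintegral_prod_pi μ (by fun_prop)]
      congr 1
      ext y
      simp only [geomMean, groupDensities, ← Finset.prod_mul_distrib]
      rw [← ENNReal.ofNNReal_finsetProd, ENNReal.coe_inj]
      exact map_prod NNReal.sqrtHom _ _
    rw [lintegral_stepMeasure hf measurable_geomMean]
    simp only [hg]
    rw [← p.tsum_coe]
    obtain ⟨m, hm, hpm⟩ := hp
    refine ENNReal.tsum_lt_tsum (i := m) ?_ (fun a => ?_) ?_
    · refine ne_top_of_le_ne_top ENNReal.one_ne_top ?_
      rw [← p.tsum_coe]
      exact ENNReal.tsum_le_tsum fun a => mul_le_of_le_one_right zero_le (pow_le_one₀ zero_le hθ.le)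
    · exact mul_le_of_le_one_right zero_le (pow_le_one₀ zero_le hθ.le)
    · have := (ENNReal.mul_lt_mul_iff_right hpm.ne' (p.apply_ne_top m)).2
        (pow_lt_one₀ zero_le hθ hm.ne')
      rwa [mul_one] at this

theorem tsum_fin_succ {k : ℕ} (F : (Fin (k + 1) → 𝒢) → ℝ≥0∞) :
    ∑' n, F n = ∑' n : Fin k → 𝒢, ∑' m : 𝒢, F (Fin.snoc (α := fun _ => 𝒢) n m) := by
  rw [← (Fin.snocEquiv fun _ : Fin (k + 1) => (𝒢 : Type)).tsum_eq, ENNReal.tsum_prod',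
    ENNReal.tsum_comm]
  rfl

/-- One step of the walk: integrating out the last group, with a weight depending on its size,
applies the transition operator. -/
theorem levelSum_succ_weighted (hf : ∀ i, Measurable (f i)) {k : ℕ}
    {g : (n : Fin k → 𝒢) → Sample 𝔛 n → ℝ≥0∞} (hg : ∀ n, Measurable (g n)) (e : 𝒢 → ℝ≥0)
    {H : ℝ≥0 × ℝ≥0 → ℝ≥0∞} (hH : Measurable H) :
    levelSum μ p (k + 1) (fun n x => g (fun i => n i.castSucc) (fun i => x i.castSucc)
        * (e (n (Fin.last k)) * H (densities f n x)))
      = levelSum μ p k fun n x =>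
        g n x * transition (stepMeasure μ f fun m => p m * e m) H (densities f n x) := by
  -- The sample space depends on `n`. Expressing the integral through a function of the initial
  -- sizes and the last size lets `Fin.snoc` be simplified in non-dependent arguments.
  obtain ⟨Φ, hΦ⟩ : ∃ Φ : (Fin k → 𝒢) → 𝒢 → ℝ≥0∞, ∀ n m, Φ n m = sizeProb p n *
      ∫⁻ x, g n x * (p m * e m * ∫⁻ y, H (densities f n x * groupDensities f m y)
        ∂(Measure.pi fun _ : Fin (m : ℕ) => μ)) ∂sampleMeasure μ n := ⟨_, fun _ _ => rfl⟩
  have key : ∀ n : Fin (k + 1) → 𝒢,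
      sizeProb p n * ∫⁻ x, g (fun i => n i.castSucc) (fun i => x i.castSucc)
          * (e (n (Fin.last k)) * H (densities f n x)) ∂sampleMeasure μ n
        = Φ (fun i : Fin k => n i.castSucc) (n (Fin.last k)) := by
    intro n
    have hd := measurable_densities hf fun i : Fin k => n i.castSucc
    have hd' := measurable_groupDensities hf (n (Fin.last k))
    have hg' := hg fun i : Fin k => n i.castSucc
    have hF : Measurable fun q : Sample 𝔛 (fun i : Fin k => n i.castSucc)
        × (Fin (n (Fin.last k) : ℕ) → 𝔛) => g (fun i => n i.castSucc) q.1
          * (e (n (Fin.last k)) * H (densities f (fun i => n i.castSucc) q.1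
            * groupDensities f (n (Fin.last k)) q.2)) := by fun_prop
    simp only [densities_succ]
    rw [hΦ, sampleMeasure, lintegral_pi_succ
      (fun i : Fin (k + 1) => Measure.pi fun _ : Fin (n i : ℕ) => μ) hF]
    simp only [sizeProb, Fin.prod_univ_castSucc]
    rw [mul_assoc, ← lintegral_const_mul' _ _ (p.apply_ne_top _)]
    congr 2
    ext x
    rw [lintegral_const_mul _ (by fun_prop), lintegral_const_mul _ (by fun_prop)]
    ring
  rw [levelSum, tsum_fin_succ, levelSum]
  refine tsum_congr fun n => ?_
  have key' : ∀ m, Φ (fun i : Fin k => (Fin.snoc n m : Fin (k + 1) → 𝒢) i.castSucc)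
      ((Fin.snoc n m : Fin (k + 1) → 𝒢) (Fin.last k)) = Φ n m := by
    intro m
    simp only [Fin.snoc_castSucc, Fin.snoc_last]
  simp only [key, key', hΦ]
  rw [ENNReal.tsum_mul_left]
  congr 1
  have hd := measurable_densities hf n
  have hg' := hg n
  have hm : ∀ m : 𝒢, Measurable fun x => ∫⁻ y, H (densities f n x * groupDensities f m y)
      ∂(Measure.pi fun _ : Fin (m : ℕ) => μ) := by
    intro m
    have hd' := measurable_groupDensities hf m
    have : Measurable fun q : Sample 𝔛 n × (Fin (m : ℕ) → 𝔛) =>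
        H (densities f n q.1 * groupDensities f m q.2) := by fun_prop
    exact this.lintegral_prod_right'
  rw [← lintegral_tsum fun m => ?_]
  · congr 1
    ext x
    rw [ENNReal.tsum_mul_left, transition_stepMeasure hf hH]
  · exact (hg'.mul ((hm m).const_mul _)).aemeasurable

theorem levelSum_succ_densities (hf : ∀ i, Measurable (f i)) {k : ℕ}
    {g : (n : Fin k → 𝒢) → Sample 𝔛 n → ℝ≥0∞} (hg : ∀ n, Measurable (g n))
    {H : ℝ≥0 × ℝ≥0 → ℝ≥0∞} (hH : Measurable H) :
    levelSum μ p (k + 1) (fun n x =>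
        g (fun i => n i.castSucc) (fun i => x i.castSucc) * H (densities f n x))
      = levelSum μ p k fun n x => g n x * transition (stepMeasure μ f p) H (densities f n x) := by
  simpa using levelSum_succ_weighted (μ := μ) (p := p) hf hg (fun _ => 1) hH

end GroupSequential

/-! ### Pending probabilities and the Wald identity for the cost. -/

namespace GroupSequential

variable {𝔛 : Type*} {𝒢 : Set ℕ} {k : ℕ}

/-- The coordinate of a state that belongs to the hypothesis `Hᵢ`. -/
noncomputable def coord (i : Fin 2) (u : ℝ≥0 × ℝ≥0) : ℝ≥0∞ := (![u.1, u.2] i : ℝ≥0)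

theorem measurable_coord (i : Fin 2) : Measurable (coord i) := by
  unfold coord
  fin_cases i <;> simp <;> fun_prop

theorem coord_densities (f : Fin 2 → 𝔛 → ℝ≥0) (i : Fin 2) (n : Fin k → 𝒢) (x : Sample 𝔛 n) :
    coord i (densities f n x) = jointDensity (f i) n x := by
  fin_cases i <;> rfl

variable [MeasurableSpace 𝔛] {μ : Measure 𝔛} {f : Fin 2 → 𝔛 → ℝ≥0}
  {p : PMF 𝒢}

section LevelSum

variable {g g' : (n : Fin k → 𝒢) → Sample 𝔛 n → ℝ≥0∞}

theorem levelSum_mono (h : ∀ n x, g n x ≤ g' n x) : levelSum μ p k g ≤ levelSum μ p k g' :=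
  ENNReal.tsum_le_tsum fun n => by gcongr; exact h n _

theorem levelSum_add (hg : ∀ n, Measurable (g n)) :
    levelSum μ p k (fun n x => g n x + g' n x) = levelSum μ p k g + levelSum μ p k g' := by
  simp only [levelSum, lintegral_add_left (hg _), mul_add]
  exact ENNReal.tsum_add

theorem levelSum_const_mul (b : ℝ≥0) :
    levelSum μ p k (fun n x => b * g n x) = b * levelSum μ p k g := by
  simp only [levelSum, lintegral_const_mul' _ _ ENNReal.coe_ne_top]
  rw [← ENNReal.tsum_mul_left]
  congr 1
  ext n
  ring

end LevelSum

theorem lintegral_sampleLaw {d : 𝔛 → ℝ≥0} (hd : Measurable d) (n : Fin k → 𝒢)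
    {F : Sample 𝔛 n → ℝ≥0∞} (hF : Measurable F) :
    ∫⁻ x, F x ∂sampleLaw μ d n = ∫⁻ x, F x * jointDensity d n x ∂sampleMeasure μ n := by
  rw [sampleLaw, lintegral_withDensity_eq_lintegral_mul _
    (measurable_jointDensity hd n).coe_nnreal_ennreal hF]
  simp only [Pi.mul_apply, mul_comm]

/-- The weights `q` need not have sum one: the cost-weighted step with weights p(m)e(m) is used in
the Wald identity. -/
theorem transition_coord_stepMeasure [SigmaFinite μ] (hf : ∀ i, Measurable (f i))
    (hf_one : ∀ i, ∫⁻ x, (f i x : ℝ≥0∞) ∂μ = 1) (q : 𝒢 → ℝ≥0∞) (i : Fin 2) (u : ℝ≥0 × ℝ≥0) :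
    transition (stepMeasure μ f q) (coord i) u = (∑' m, q m) * coord i u := by
  fin_cases i
  · change ∫⁻ w, ((u.1 * w.1 : ℝ≥0) : ℝ≥0∞) ∂stepMeasure μ f q = (∑' m, q m) * u.1
    simp only [ENNReal.coe_mul]
    rw [lintegral_const_mul' _ _ ENNReal.coe_ne_top, lintegral_stepMeasure_fst hf hf_one, mul_comm]
  · change ∫⁻ w, ((u.2 * w.2 : ℝ≥0) : ℝ≥0∞) ∂stepMeasure μ f q = (∑' m, q m) * u.2
    simp only [ENNReal.coe_mul]
    rw [lintegral_const_mul' _ _ ENNReal.coe_ne_top, lintegral_stepMeasure_snd hf hf_one, mul_comm]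

/-- The conditional probability not to stop with any of the first `k` groups. -/
noncomputable def pendingProb (ψ : RandomizedRule 𝔛 𝒢) (n : Fin k → 𝒢) (x : Sample 𝔛 n) :
    ℝ≥0∞ :=
  ∏ j : Fin k, (1 - ψ.val j
    (fun i : Fin (j + 1) => n (i.castLE j.isLt)) (fun i : Fin (j + 1) => x (i.castLE j.isLt)))

variable (ψ : RandomizedRule 𝔛 𝒢)

theorem continueProb_eq_pendingProb (n : Fin (k + 1) → 𝒢) (x : Sample 𝔛 n) :
    continueProb ψ n x
      = pendingProb ψ (fun i : Fin k => n i.castSucc) (fun i : Fin k => x i.castSucc) := rfl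

theorem pendingProb_succ (n : Fin (k + 1) → 𝒢) (x : Sample 𝔛 n) :
    pendingProb ψ n x = continueProb ψ n x * (1 - ψ.val k n x) := by
  rw [pendingProb, Fin.prod_univ_castSucc]
  rfl

theorem pendingProb_le_one (n : Fin k → 𝒢) (x : Sample 𝔛 n) : pendingProb ψ n x ≤ 1 :=
  Finset.prod_le_one' fun _ _ => tsub_le_self

theorem measurable_pendingProb (n : Fin k → 𝒢) : Measurable (pendingProb ψ n) := by
  unfold pendingProb
  refine Finset.measurable_prod _ fun j _ => measurable_const.sub ?_
  exact (ψ.measurable_val _ _).comp (by fun_prop)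

theorem measurable_continueProb (n : Fin (k + 1) → 𝒢) : Measurable (continueProb ψ n) :=
  (measurable_pendingProb ψ fun i : Fin k => n i.castSucc).comp
    (g := fun y : Sample 𝔛 fun i : Fin k => n i.castSucc => pendingProb ψ _ y)
    (f := fun (x : Sample 𝔛 n) (i : Fin k) => x i.castSucc) (by fun_prop)

theorem measurable_stopProb (n : Fin (k + 1) → 𝒢) : Measurable (stopProb ψ n) :=
  (measurable_continueProb ψ n).mul (ψ.measurable_val k n)

theorem stopProb_add_pendingProb (n : Fin (k + 1) → 𝒢) (x : Sample 𝔛 n) :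
    stopProb ψ n x + pendingProb ψ n x = continueProb ψ n x := by
  rw [pendingProb_succ, stopProb, ← mul_add, add_tsub_cancel_of_le (ψ.le_one k n x), mul_one]

/-- The probability of `Hᵢ` not to stop with any of the first `k` groups. -/
noncomputable def pending (μ : Measure 𝔛) (f : Fin 2 → 𝔛 → ℝ≥0) (p : PMF 𝒢)
    (ψ : RandomizedRule 𝔛 𝒢) (i : Fin 2) (k : ℕ) : ℝ≥0∞ :=
  levelSum μ p k fun n x => pendingProb ψ n x * coord i (densities f n x)

/-- The probability of `Hᵢ` to stop with the group `k + 1`. -/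
noncomputable def stopping (μ : Measure 𝔛) (f : Fin 2 → 𝔛 → ℝ≥0) (p : PMF 𝒢)
    (ψ : RandomizedRule 𝔛 𝒢) (i : Fin 2) (k : ℕ) : ℝ≥0∞ :=
  levelSum μ p (k + 1) fun n x => stopProb ψ n x * coord i (densities f n x)

theorem measurable_coord_densities (hf : ∀ i, Measurable (f i)) (i : Fin 2) (n : Fin k → 𝒢) :
    Measurable fun x => coord i (densities f n x) :=
  (measurable_coord i).comp (measurable_densities hf n)

theorem pending_zero (i : Fin 2) : pending μ f p ψ i 0 = 1 := by
  refine levelSum_zero _ fun n x => ?_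
  rw [coord_densities]
  simp [pendingProb, jointDensity]

theorem terminates_iff_tsum_stopping (hf : ∀ i, Measurable (f i)) (i : Fin 2) :
    Terminates μ (f i) p ψ ↔ ∑' k, stopping μ f p ψ i k = 1 := by
  simp only [Terminates, stopping, levelSum, lintegral_sampleLaw (hf i) _ (measurable_stopProb ψ _),
    coord_densities]

theorem typeIError_eq (hf : ∀ i, Measurable (f i)) (φ : RandomizedRule 𝔛 𝒢) :
    typeIError μ f p ψ φ = ∑' k, levelSum μ p (k + 1) fun n x =>
      stopProb ψ n x * (φ.val k n x * (densities f n x).1) := by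
  simp only [typeIError, levelSum, lintegral_sampleLaw (hf 0) _
    ((measurable_stopProb ψ _).fun_mul (φ.measurable_val _ _)), mul_assoc]
  rfl

theorem typeIIError_eq (hf : ∀ i, Measurable (f i)) (φ : RandomizedRule 𝔛 𝒢) :
    typeIIError μ f p ψ φ = ∑' k, levelSum μ p (k + 1) fun n x =>
      stopProb ψ n x * ((1 - φ.val k n x) * (densities f n x).2) := by
  simp only [typeIIError, levelSum, lintegral_sampleLaw (hf 1) _
    ((measurable_stopProb ψ _).fun_mul (measurable_const.fun_sub (φ.measurable_val _ _))), mul_assoc]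
  rfl

theorem averageCost_eq (hf : ∀ i, Measurable (f i)) (c : 𝒢 → ℝ≥0) (i : Fin 2) :
    averageCost μ f p c i ψ = ∑' k, levelSum μ p (k + 1) fun n x =>
      stopProb ψ n x * (totalCost c n * coord i (densities f n x)) := by
  simp only [averageCost, levelSum, lintegral_sampleLaw (hf i) _ (measurable_stopProb ψ _),
    coord_densities]
  refine tsum_congr fun k => tsum_congr fun n => ?_
  rw [mul_assoc, ← lintegral_const_mul _ ((measurable_stopProb ψ n).fun_mul
    (measurable_jointDensity (hf i) n).coe_nnreal_ennreal)]
  congr 2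
  ext x
  ring

variable [SigmaFinite μ]

theorem levelSum_continueProb (hf : ∀ i, Measurable (f i)) {H : ℝ≥0 × ℝ≥0 → ℝ≥0∞}
    (hH : Measurable H) :
    levelSum μ p (k + 1) (fun n x => continueProb ψ n x * H (densities f n x))
      = levelSum μ p k fun n x =>
        pendingProb ψ n x * transition (stepMeasure μ f p) H (densities f n x) :=
  levelSum_succ_densities hf (measurable_pendingProb ψ) hH

theorem pending_eq_stopping_add (hf : ∀ i, Measurable (f i))
    (hf_one : ∀ i, ∫⁻ x, (f i x : ℝ≥0∞) ∂μ = 1) (i : Fin 2) (k : ℕ) :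
    pending μ f p ψ i k = stopping μ f p ψ i k + pending μ f p ψ i (k + 1) := by
  have h := levelSum_continueProb (μ := μ) (p := p) (k := k) ψ hf (measurable_coord i)
  simp only [transition_coord_stepMeasure hf hf_one, p.tsum_coe, one_mul] at h
  rw [pending, ← h, stopping, pending, ← levelSum_add fun n =>
    (measurable_stopProb ψ n).fun_mul (measurable_coord_densities hf i n)]
  simp only [← add_mul, stopProb_add_pendingProb]

theorem sum_stopping_add_pending (hf : ∀ i, Measurable (f i))
    (hf_one : ∀ i, ∫⁻ x, (f i x : ℝ≥0∞) ∂μ = 1) (i : Fin 2) (k : ℕ) :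
    ∑ j ∈ Finset.range k, stopping μ f p ψ i j + pending μ f p ψ i k = 1 := by
  induction k with
  | zero => simp [pending_zero]
  | succ k ih =>
    rw [Finset.sum_range_succ, add_assoc, ← pending_eq_stopping_add ψ hf hf_one, ih]

theorem terminates_iff_tendsto_pending (hf : ∀ i, Measurable (f i))
    (hf_one : ∀ i, ∫⁻ x, (f i x : ℝ≥0∞) ∂μ = 1) (i : Fin 2) :
    Terminates μ (f i) p ψ ↔
      Filter.Tendsto (pending μ f p ψ i) Filter.atTop (nhds 0) := by
  rw [terminates_iff_tsum_stopping ψ hf]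
  have hsum := sum_stopping_add_pending (p := p) ψ hf hf_one i
  have hlim := ENNReal.tendsto_nat_tsum (stopping μ f p ψ i)
  have hle : ∀ k, ∑ j ∈ Finset.range k, stopping μ f p ψ i j ≤ 1 := fun k =>
    le_self_add.trans (hsum k).le
  constructor
  · intro h
    rw [h] at hlim
    have := ENNReal.Tendsto.sub (tendsto_const_nhds (x := (1 : ℝ≥0∞))) hlim
      (Or.inl ENNReal.one_ne_top)
    rw [tsub_self] at this
    refine this.congr fun k => ?_
    rw [← hsum k]
    exact ENNReal.add_sub_cancel_left (ne_top_of_le_ne_top ENNReal.one_ne_top (hle k))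
  · intro h
    have := hlim.add h
    simp only [hsum, add_zero] at this
    exact tendsto_nhds_unique this tendsto_const_nhds

section Cost

/-- The cost of the first groups when the group `i + 1` of size `m` costs `w i m`. -/
noncomputable def weightedCost (w : ℕ → 𝒢 → ℝ≥0) (n : Fin k → 𝒢) : ℝ≥0 := ∑ i : Fin k, w i (n i)

/-- The size of the next group is independent of the past, so its expected price is paid by the mass
still pending; the accumulated cost then goes to the mass that stops and to the mass that continues.
-/
theorem weightedCost_balance (hf : ∀ i, Measurable (f i))
    (hf_one : ∀ i, ∫⁻ x, (f i x : ℝ≥0∞) ∂μ = 1) (w : ℕ → 𝒢 → ℝ≥0) (i : Fin 2) (k : ℕ) :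
    levelSum μ p k (fun n x => pendingProb ψ n x * (weightedCost w n * coord i (densities f n x)))
        + (∑' m, p m * w k m) * pending μ f p ψ i k
      = levelSum μ p (k + 1) (fun n x =>
          stopProb ψ n x * (weightedCost w n * coord i (densities f n x)))
        + levelSum μ p (k + 1) (fun n x =>
          pendingProb ψ n x * (weightedCost w n * coord i (densities f n x))) := by
  have hc := measurable_coord i
  have h1 := levelSum_succ_densities (μ := μ) (p := p) (k := k) hf
    (g := fun n x => pendingProb ψ n x * (weightedCost w n : ℝ≥0∞))
    (fun n => (measurable_pendingProb ψ n).mul_const _) hc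
  have h2 := levelSum_succ_weighted (μ := μ) (p := p) (k := k) hf (measurable_pendingProb ψ)
    (w k) hc
  simp only [transition_coord_stepMeasure hf hf_one, p.tsum_coe, one_mul, mul_assoc] at h1 h2
  have h3 : levelSum μ p k (fun n x =>
      pendingProb ψ n x * ((∑' m, p m * w k m) * coord i (densities f n x)))
      = (∑' m, p m * w k m) * pending μ f p ψ i k := by
    simp only [pending, levelSum]
    rw [← ENNReal.tsum_mul_left]
    refine tsum_congr fun n => ?_
    rw [mul_left_comm, ← lintegral_const_mul _ ((measurable_pendingProb ψ n).fun_mul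
      (measurable_coord_densities hf i n))]
    congr 2
    ext x
    ring
  rw [← h1, ← h3, ← h2, ← levelSum_add, ← levelSum_add fun n =>
    (measurable_stopProb ψ n).fun_mul ((measurable_coord_densities hf i n).const_mul _)]
  · congr 1
    ext n x
    rw [← add_mul, stopProb_add_pendingProb, continueProb_eq_pendingProb, ← mul_add, ← add_mul]
    simp [weightedCost, Fin.sum_univ_castSucc]
  · intro n
    exact (measurable_continueProb ψ n).fun_mul ((measurable_coord_densities hf i n).const_mul _)

theorem sum_weightedCost (hf : ∀ i, Measurable (f i))
    (hf_one : ∀ i, ∫⁻ x, (f i x : ℝ≥0∞) ∂μ = 1) (w : ℕ → 𝒢 → ℝ≥0) (i : Fin 2) (k : ℕ) :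
    ∑ j ∈ Finset.range k, (∑' m, p m * w j m) * pending μ f p ψ i j
      = ∑ j ∈ Finset.range k, levelSum μ p (j + 1) (fun n x =>
          stopProb ψ n x * (weightedCost w n * coord i (densities f n x)))
        + levelSum μ p k (fun n x =>
          pendingProb ψ n x * (weightedCost w n * coord i (densities f n x))) := by
  induction k with
  | zero =>
    rw [levelSum_zero (a := 0)]
    · simp
    · intro n x
      simp [weightedCost]
  | succ k ih =>
    rw [Finset.sum_range_succ, ih, Finset.sum_range_succ, add_assoc, add_assoc,
      weightedCost_balance ψ hf hf_one]

/-- The telescoped balance without the cost carried by the mass still pending, which is nonnegative;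
termination is not needed. -/
theorem averageCost_le (hf : ∀ i, Measurable (f i))
    (hf_one : ∀ i, ∫⁻ x, (f i x : ℝ≥0∞) ∂μ = 1) (c : 𝒢 → ℝ≥0) (i : Fin 2) :
    averageCost μ f p c i ψ ≤ (∑' m, p m * c m) * ∑' k, pending μ f p ψ i k := by
  rw [averageCost_eq ψ hf, ENNReal.tsum_eq_iSup_nat, ← ENNReal.tsum_mul_left]
  refine iSup_le fun k => le_trans ?_ (ENNReal.sum_le_tsum (Finset.range k))
  rw [sum_weightedCost ψ hf hf_one fun _ => c]
  refine le_trans (le_of_eq ?_) le_self_add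
  simp only [weightedCost, totalCost, ENNReal.ofNNReal_finsetSum]

theorem le_averageCost (hf : ∀ i, Measurable (f i))
    (hf_one : ∀ i, ∫⁻ x, (f i x : ℝ≥0∞) ∂μ = 1) (c : 𝒢 → ℝ≥0) (i : Fin 2)
    (hψ : Terminates μ (f i) p ψ) :
    (∑' m, p m * c m) * ∑' k, pending μ f p ψ i k ≤ averageCost μ f p c i ψ := by
  rw [terminates_iff_tendsto_pending ψ hf hf_one] at hψ
  have key : ∀ (S : Finset 𝒢) (J : ℕ),
      (∑ m ∈ S, p m * c m) * ∑ j ∈ Finset.range J, pending μ f p ψ i j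
        ≤ averageCost μ f p c i ψ := by
    classical
    intro S J
    -- Only groups before time `J` with size in the finite set `S` are charged. The accumulated cost
    -- is then bounded, so the part carried by the pending mass vanishes in the limit by
    -- termination; the suprema over `S` and `J` restore the full cost.
    set w : ℕ → 𝒢 → ℝ≥0 := fun j m => if j < J ∧ m ∈ S then c m else 0 with hw
    have hwc : ∀ j m, w j m ≤ c m := fun j m => by
      simp only [hw]; split_ifs <;> simp
    have hbound : ∀ (k : ℕ) (n : Fin k → 𝒢), weightedCost w n ≤ J * ∑ m ∈ S, c m := by
      intro k n
      have h1 : ∀ j : Fin k, w j (n j) ≤ if (j : ℕ) < J then ∑ m ∈ S, c m else 0 := by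
        intro j
        simp only [hw]
        by_cases hj : (j : ℕ) < J <;> by_cases hm : n j ∈ S <;> simp only [hj, hm, and_self,
          and_true, and_false, if_true, if_false, zero_le, le_refl]
        exact Finset.single_le_sum (f := c) (fun _ _ => zero_le) hm
      calc weightedCost w n ≤ ∑ j : Fin k, if (j : ℕ) < J then ∑ m ∈ S, c m else 0 :=
            Finset.sum_le_sum fun j _ => h1 j
        _ = ∑ j ∈ Finset.range k, if j < J then ∑ m ∈ S, c m else 0 :=
            Fin.sum_univ_eq_sum_range (fun j => if j < J then ∑ m ∈ S, c m else 0) k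
        _ ≤ J * ∑ m ∈ S, c m := by
            rw [← Finset.sum_filter, Finset.sum_const, nsmul_eq_mul]
            gcongr
            rw [← Finset.card_range J]
            exact_mod_cast Finset.card_le_card fun j hj => by
              simpa using (Finset.mem_filter.1 hj).2
    have hmean : ∀ j < J, ∑' m, p m * (w j m : ℝ≥0∞) = ∑ m ∈ S, p m * c m := by
      intro j hj
      rw [tsum_eq_sum (s := S)]
      · exact Finset.sum_congr rfl fun m hm => by simp [hw, hj, hm]
      · intro m hm
        simp [hw, hm]
    have hlim : Filter.Tendsto (fun k => averageCost μ f p c i ψ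
        + ((J * ∑ m ∈ S, c m : ℝ≥0) : ℝ≥0∞) * pending μ f p ψ i k) Filter.atTop
        (nhds (averageCost μ f p c i ψ + ((J * ∑ m ∈ S, c m : ℝ≥0) : ℝ≥0∞) * 0)) :=
      (ENNReal.Tendsto.const_mul hψ (Or.inr ENNReal.coe_ne_top)).const_add _
    rw [mul_zero, add_zero] at hlim
    refine ge_of_tendsto hlim ((Filter.eventually_ge_atTop J).mono fun k hk => ?_)
    calc (∑ m ∈ S, p m * c m) * ∑ j ∈ Finset.range J, pending μ f p ψ i j
        = ∑ j ∈ Finset.range J, (∑' m, p m * w j m) * pending μ f p ψ i j := by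
          rw [Finset.mul_sum]
          exact Finset.sum_congr rfl fun j hj => by rw [hmean j (Finset.mem_range.1 hj)]
      _ ≤ ∑ j ∈ Finset.range k, (∑' m, p m * w j m) * pending μ f p ψ i j :=
          Finset.sum_le_sum_of_subset (Finset.range_mono hk)
      _ ≤ _ := by
          rw [sum_weightedCost ψ hf hf_one w, averageCost_eq ψ hf]
          refine add_le_add (le_trans (Finset.sum_le_sum fun j _ => ?_)
            (ENNReal.sum_le_tsum (Finset.range k))) ?_
          · refine levelSum_mono fun n x => ?_
            gcongr
            rw [totalCost, weightedCost, ENNReal.ofNNReal_finsetSum]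
            exact Finset.sum_le_sum fun l _ => by exact_mod_cast hwc l (n l)
          · rw [pending, ← levelSum_const_mul]
            refine levelSum_mono fun n x => ?_
            rw [mul_left_comm]
            gcongr
            exact hbound k n
  rw [ENNReal.tsum_eq_iSup_sum, ENNReal.tsum_eq_iSup_nat, ENNReal.iSup_mul]
  refine iSup_le fun S => ?_
  rw [ENNReal.mul_iSup]
  exact iSup_le fun J => key S J

end Cost

end GroupSequential

/-! ### Verification: bounds for the weighted risk, and termination. -/

namespace GroupSequential

variable {𝔛 : Type*} {𝒢 : Set ℕ} {k : ℕ}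

theorem mul_fst_le_snd_of_le_likelihoodRatio {f : Fin 2 → 𝔛 → ℝ≥0} {n : Fin k → 𝒢}
    {x : Sample 𝔛 n} {b : ℝ≥0} (h : (b : ℝ≥0∞) ≤ likelihoodRatio f n x) :
    b * (densities f n x).1 ≤ (densities f n x).2 := by
  have := ENNReal.mul_le_of_le_div h
  exact_mod_cast this

theorem snd_le_mul_fst_of_likelihoodRatio_le {f : Fin 2 → 𝔛 → ℝ≥0} {n : Fin k → 𝒢}
    {x : Sample 𝔛 n} {b : ℝ≥0} (h : likelihoodRatio f n x ≤ b) :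
    (densities f n x).2 ≤ b * (densities f n x).1 := by
  rw [likelihoodRatio, ENNReal.div_le_iff_le_mul (Or.inr ENNReal.coe_ne_top)
    (Or.inl ENNReal.coe_ne_top)] at h
  exact_mod_cast h

variable [MeasurableSpace 𝔛] {μ : Measure 𝔛} {f : Fin 2 → 𝔛 → ℝ≥0} {p : PMF 𝒢}

/-- The part of the weighted error probabilities that comes from stopping with the group
`k + 1`. -/
noncomputable def errorLoss (μ : Measure 𝔛) (f : Fin 2 → 𝔛 → ℝ≥0) (p : PMF 𝒢)
    (ψ φ : RandomizedRule 𝔛 𝒢) (l₀ l₁ : ℝ≥0) (k : ℕ) : ℝ≥0∞ :=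
  levelSum μ p (k + 1) fun n x => stopProb ψ n x *
    (l₀ * (φ.val k n x * (densities f n x).1) + l₁ * ((1 - φ.val k n x) * (densities f n x).2))

theorem tsum_errorLoss (hf : ∀ i, Measurable (f i)) (ψ φ : RandomizedRule 𝔛 𝒢) (l₀ l₁ : ℝ≥0) :
    ∑' k, errorLoss μ f p ψ φ l₀ l₁ k
      = l₀ * typeIError μ f p ψ φ + l₁ * typeIIError μ f p ψ φ := by
  rw [typeIError_eq ψ hf, typeIIError_eq ψ hf, ← ENNReal.tsum_mul_left, ← ENNReal.tsum_mul_left,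
    ← ENNReal.tsum_add]
  refine tsum_congr fun k => ?_
  rw [← levelSum_const_mul, ← levelSum_const_mul, ← levelSum_add, errorLoss]
  · congr 1
    ext n x
    ring
  · intro n
    exact ((measurable_stopProb ψ n).fun_mul ((φ.measurable_val k n).fun_mul
      (measurable_densities hf n).fst.coe_nnreal_ennreal)).const_mul _

/-- The cost of observing one more group from the state `u` and then paying `R`: the two hypotheses
have the costs `b₀` and `b₁` per group and weights given by the coordinates of `u`. -/
noncomputable def continuationCost (μ : Measure 𝔛) (f : Fin 2 → 𝔛 → ℝ≥0) (p : PMF 𝒢)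
    (b₀ b₁ : ℝ≥0) (R : ℝ≥0 × ℝ≥0 → ℝ≥0∞) (u : ℝ≥0 × ℝ≥0) : ℝ≥0∞ :=
  (b₀ * u.1 + b₁ * u.2) + transition (stepMeasure μ f p) R u

theorem levelSum_pendingProb_linear (hf : ∀ i, Measurable (f i)) (ψ : RandomizedRule 𝔛 𝒢)
    (b₀ b₁ : ℝ≥0) :
    levelSum μ p k (fun n x => pendingProb ψ n x
        * (b₀ * ((densities f n x).1 : ℝ≥0∞) + b₁ * ((densities f n x).2 : ℝ≥0∞)))
      = b₀ * pending μ f p ψ 0 k + b₁ * pending μ f p ψ 1 k := by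
  rw [pending, pending, ← levelSum_const_mul, ← levelSum_const_mul, ← levelSum_add]
  · congr 1
    ext n x
    simp only [coord_densities]
    simp only [densities]
    ring
  · intro n
    exact ((measurable_pendingProb ψ n).fun_mul (measurable_coord_densities hf 0 n)).const_mul _

variable [SigmaFinite μ] {l₀ l₁ b₀ b₁ : ℝ≥0} {R : ℝ≥0 × ℝ≥0 → ℝ≥0∞}

theorem levelSum_continuationCost (hf : ∀ i, Measurable (f i)) (hR : Measurable R)
    (ψ : RandomizedRule 𝔛 𝒢) :
    levelSum μ p k (fun n x =>
        pendingProb ψ n x * continuationCost μ f p b₀ b₁ R (densities f n x))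
      = (b₀ * pending μ f p ψ 0 k + b₁ * pending μ f p ψ 1 k)
        + levelSum μ p (k + 1) fun n x => continueProb ψ n x * R (densities f n x) := by
  rw [levelSum_continueProb ψ hf hR, ← levelSum_pendingProb_linear hf, ← levelSum_add]
  · simp only [continuationCost, mul_add]
  · intro n
    have h₀ := (measurable_densities hf n).fst.coe_nnreal_ennreal
    have h₁ := (measurable_densities hf n).snd.coe_nnreal_ennreal
    exact (measurable_pendingProb ψ n).fun_mul ((h₀.const_mul _).fun_add (h₁.const_mul _))

theorem measurable_stopProb_mul_loss (hf : ∀ i, Measurable (f i)) (ψ φ : RandomizedRule 𝔛 𝒢)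
    (n : Fin (k + 1) → 𝒢) :
    Measurable fun x => stopProb ψ n x * (l₀ * (φ.val k n x * (densities f n x).1)
      + l₁ * ((1 - φ.val k n x) * (densities f n x).2)) := by
  have h₀ := (measurable_densities hf n).fst.coe_nnreal_ennreal
  have h₁ := (measurable_densities hf n).snd.coe_nnreal_ennreal
  have hφ := φ.measurable_val k n
  exact (measurable_stopProb ψ n).fun_mul (((hφ.fun_mul h₀).const_mul _).fun_add
    (((measurable_const.fun_sub hφ).fun_mul h₁).const_mul _))

/-- No terminating test has a smaller weighted risk than the value of the stopping problem. -/
theorem continuationCost_le_risk (hf : ∀ i, Measurable (f i))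
    (hf_one : ∀ i, ∫⁻ x, (f i x : ℝ≥0∞) ∂μ = 1) (hR : Measurable R)
    (hR₀ : ∀ u, R u ≤ l₀ * u.1) (hR₁ : ∀ u, R u ≤ l₁ * u.2)
    (hRc : ∀ u, R u ≤ continuationCost μ f p b₀ b₁ R u) (ψ φ : RandomizedRule 𝔛 𝒢)
    (hψ₀ : Terminates μ (f 0) p ψ) (hψ₁ : Terminates μ (f 1) p ψ) :
    continuationCost μ f p b₀ b₁ R 1
      ≤ (b₀ * ∑' k, pending μ f p ψ 0 k + b₁ * ∑' k, pending μ f p ψ 1 k)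
        + (l₀ * typeIError μ f p ψ φ + l₁ * typeIIError μ f p ψ φ) := by
  rw [terminates_iff_tendsto_pending ψ hf hf_one] at hψ₀ hψ₁
  rw [← tsum_errorLoss hf, ← ENNReal.tsum_mul_left, ← ENNReal.tsum_mul_left, ← ENNReal.tsum_add,
    ← ENNReal.tsum_add]
  set V : ℕ → ℝ≥0∞ := fun k => levelSum μ p k fun n x =>
    pendingProb ψ n x * continuationCost μ f p b₀ b₁ R (densities f n x) with hV
  have hstep : ∀ k, V k ≤ (b₀ * pending μ f p ψ 0 k + b₁ * pending μ f p ψ 1 k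
      + errorLoss μ f p ψ φ l₀ l₁ k) + V (k + 1) := by
    intro k
    simp only [hV]
    rw [levelSum_continuationCost hf hR, add_assoc _ (errorLoss μ f p ψ φ l₀ l₁ k), errorLoss,
      ← levelSum_add (measurable_stopProb_mul_loss hf ψ φ)]
    refine add_le_add le_rfl (levelSum_mono fun n x => ?_)
    rw [← stopProb_add_pendingProb, add_mul]
    gcongr
    -- A randomized decision mixes the two losses, each of which is at least R.
    · calc R (densities f n x)
          = φ.val k n x * R (densities f n x) + (1 - φ.val k n x) * R (densities f n x) := by
            rw [← add_mul, add_tsub_cancel_of_le (φ.le_one k n x), one_mul]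
        _ ≤ φ.val k n x * (l₀ * (densities f n x).1)
            + (1 - φ.val k n x) * (l₁ * (densities f n x).2) := by
            gcongr
            · exact hR₀ _
            · exact hR₁ _
        _ = _ := by ring
    · exact hRc _
  have hiter : ∀ k, V 0 ≤ ∑ j ∈ Finset.range k, (b₀ * pending μ f p ψ 0 j
      + b₁ * pending μ f p ψ 1 j + errorLoss μ f p ψ φ l₀ l₁ j) + V k := by
    intro k
    induction k with
    | zero => simp
    | succ k ih =>
      refine ih.trans ?_
      rw [Finset.sum_range_succ, add_assoc]
      gcongr
      exact hstep k
  have hV0 : V 0 = continuationCost μ f p b₀ b₁ R 1 := by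
    refine levelSum_zero _ fun n x => ?_
    have : densities f n x = 1 := by simp [densities, jointDensity, Prod.one_eq_mk]
    simp [pendingProb, this]
  -- The remainder is controlled by the pending probabilities; this is where termination of the
  -- competitor enters.
  have hVk : ∀ k, V k ≤ (b₀ * pending μ f p ψ 0 k + b₁ * pending μ f p ψ 1 k)
      + l₀ * pending μ f p ψ 0 k := by
    intro k
    simp only [hV]
    rw [levelSum_continuationCost hf hR]
    gcongr
    have h := levelSum_continueProb (μ := μ) (p := p) (k := k) ψ hf (measurable_coord 0)
    simp only [transition_coord_stepMeasure hf hf_one, p.tsum_coe, one_mul] at h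
    rw [pending, ← h, ← levelSum_const_mul]
    refine levelSum_mono fun n x => ?_
    rw [mul_left_comm]
    gcongr
    exact hR₀ _
  have hlim : Filter.Tendsto (fun k => (∑' j, (b₀ * pending μ f p ψ 0 j
      + b₁ * pending μ f p ψ 1 j + errorLoss μ f p ψ φ l₀ l₁ j))
      + ((b₀ * pending μ f p ψ 0 k + b₁ * pending μ f p ψ 1 k) + l₀ * pending μ f p ψ 0 k))
      Filter.atTop (nhds ((∑' j, (b₀ * pending μ f p ψ 0 j
      + b₁ * pending μ f p ψ 1 j + errorLoss μ f p ψ φ l₀ l₁ j))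
      + ((b₀ * 0 + b₁ * 0) + l₀ * 0))) := by
    have hmul : ∀ (b : ℝ≥0) {a : ℕ → ℝ≥0∞}, Filter.Tendsto a Filter.atTop (nhds 0) →
        Filter.Tendsto (fun k => b * a k) Filter.atTop (nhds (b * 0)) := fun b a ha =>
      ENNReal.Tendsto.const_mul ha (Or.inr ENNReal.coe_ne_top)
    exact (((hmul b₀ hψ₀).add (hmul b₁ hψ₁)).add (hmul l₀ hψ₀)).const_add _
  simp only [mul_zero, add_zero] at hlim
  rw [← hV0]
  exact ge_of_tendsto' hlim fun k => (hiter k).trans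
    (add_le_add (ENNReal.sum_le_tsum _) (hVk k))

/-- A test that always acts as the value function prescribes attains the value of the stopping
problem. -/
theorem risk_le_continuationCost (hf : ∀ i, Measurable (f i)) (hR : Measurable R)
    (ψ φ : RandomizedRule 𝔛 𝒢)
    (haction : ∀ (k : ℕ) (n : Fin (k + 1) → 𝒢) (x : Sample 𝔛 n),
      ψ.val k n x * (l₀ * (φ.val k n x * (densities f n x).1)
        + l₁ * ((1 - φ.val k n x) * (densities f n x).2)) ≤ ψ.val k n x * R (densities f n x))
    (hcont : ∀ (k : ℕ) (n : Fin (k + 1) → 𝒢) (x : Sample 𝔛 n),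
      (1 - ψ.val k n x) * continuationCost μ f p b₀ b₁ R (densities f n x)
        ≤ (1 - ψ.val k n x) * R (densities f n x)) :
    (b₀ * ∑' k, pending μ f p ψ 0 k + b₁ * ∑' k, pending μ f p ψ 1 k)
        + (l₀ * typeIError μ f p ψ φ + l₁ * typeIIError μ f p ψ φ)
      ≤ continuationCost μ f p b₀ b₁ R 1 := by
  rw [← tsum_errorLoss hf, ← ENNReal.tsum_mul_left, ← ENNReal.tsum_mul_left, ← ENNReal.tsum_add,
    ← ENNReal.tsum_add]
  set V : ℕ → ℝ≥0∞ := fun k => levelSum μ p k fun n x =>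
    pendingProb ψ n x * continuationCost μ f p b₀ b₁ R (densities f n x) with hV
  have hstep : ∀ k, (b₀ * pending μ f p ψ 0 k + b₁ * pending μ f p ψ 1 k
      + errorLoss μ f p ψ φ l₀ l₁ k) + V (k + 1) ≤ V k := by
    intro k
    simp only [hV]
    rw [levelSum_continuationCost hf hR (k := k), add_assoc _ (errorLoss μ f p ψ φ l₀ l₁ k), errorLoss,
      ← levelSum_add (measurable_stopProb_mul_loss hf ψ φ)]
    refine add_le_add le_rfl (levelSum_mono fun n x => ?_)
    rw [← stopProb_add_pendingProb, add_mul, pendingProb_succ, stopProb, mul_assoc, mul_assoc,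
      mul_assoc, mul_assoc]
    exact add_le_add (mul_le_mul_right (haction k n x) _) (mul_le_mul_right (hcont k n x) _)
  have hiter : ∀ k, ∑ j ∈ Finset.range k, (b₀ * pending μ f p ψ 0 j
      + b₁ * pending μ f p ψ 1 j + errorLoss μ f p ψ φ l₀ l₁ j) + V k ≤ V 0 := by
    intro k
    induction k with
    | zero => simp
    | succ k ih =>
      refine le_trans ?_ ih
      rw [Finset.sum_range_succ, add_assoc]
      gcongr
      exact hstep k
  have hV0 : V 0 = continuationCost μ f p b₀ b₁ R 1 := by
    refine levelSum_zero _ fun n x => ?_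
    have : densities f n x = 1 := by simp [densities, jointDensity, Prod.one_eq_mk]
    simp [pendingProb, this]
  -- Only the nonnegative remainder is dropped, so termination is not needed here.
  rw [ENNReal.tsum_eq_iSup_nat, ← hV0]
  exact iSup_le fun k => le_self_add.trans (hiter k)

/-- A rule that stops as soon as the likelihood ratio leaves `[A, B]` terminates. -/
theorem terminates_of_continue_le (hf : ∀ i, Measurable (f i))
    (hf_one : ∀ i, ∫⁻ x, (f i x : ℝ≥0∞) ∂μ = 1)
    (hκ : IsLikelihoodStep (stepMeasure μ f p)) {A B : ℝ≥0} (hA : 0 < A)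
    (ψ : RandomizedRule 𝔛 𝒢)
    (hψ : ∀ (k : ℕ) (n : Fin (k + 1) → 𝒢) (x : Sample 𝔛 n), 1 - ψ.val k n x ≠ 0 →
      A * (densities f n x).1 ≤ (densities f n x).2 ∧
        (densities f n x).2 ≤ B * (densities f n x).1) (i : Fin 2) :
    Terminates μ (f i) p ψ := by
  set θ := ∫⁻ w, geomMean w ∂stepMeasure μ f p with hθ
  have hθ1 : θ < 1 := hκ.lintegral_geomMean_lt
  -- Pending after a group forces the ratio into [A, B], where each coordinate is at most a constant
  -- times the geometric mean, whose total mass after k groups is at most θ^k.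
  obtain ⟨M, hM⟩ : ∃ M : ℝ≥0, ∀ u : ℝ≥0 × ℝ≥0, A * u.1 ≤ u.2 → u.2 ≤ B * u.1 →
      coord i u ≤ M * geomMean u := by
    fin_cases i
    · exact ⟨_, fun u h _ => fst_le_inv_sqrt_mul_geomMean hA h⟩
    · exact ⟨_, fun u _ h => snd_le_sqrt_mul_geomMean h⟩
  have hgeom : ∀ k, levelSum μ p k (fun n x => geomMean (densities f n x)) ≤ θ ^ k := by
    intro k
    induction k with
    | zero =>
      rw [levelSum_zero (a := 1), pow_zero]
      intro n x
      simp [densities, jointDensity, geomMean]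
    | succ k ih =>
      have h := levelSum_succ_densities (μ := μ) (p := p) (k := k) hf (g := fun _ _ => 1)
        (fun _ => measurable_const) measurable_geomMean
      simp only [one_mul, transition_geomMean, ← hθ] at h
      obtain ⟨t, ht⟩ : ∃ t : ℝ≥0, θ = t :=
        ⟨_, (ENNReal.coe_toNNReal (ne_top_of_lt hθ1)).symm⟩
      rw [h, ht, levelSum_const_mul, pow_succ', ← ht]
      gcongr
  have hpend : ∀ k, pending μ f p ψ i (k + 1) ≤ M * θ ^ (k + 1) := by
    intro k
    refine le_trans ?_ (mul_le_mul_right (hgeom (k + 1)) _)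
    rw [pending, ← levelSum_const_mul]
    refine levelSum_mono fun n x => ?_
    by_cases h0 : 1 - ψ.val k n x = 0
    · simp [pendingProb_succ, h0]
    · exact (mul_le_of_le_one_left zero_le (pendingProb_le_one ψ n x)).trans
        (hM _ (hψ k n x h0).1 (hψ k n x h0).2)
  rw [terminates_iff_tendsto_pending ψ hf hf_one, ← Filter.tendsto_add_atTop_iff_nat 1]
  have hlim : Filter.Tendsto (fun k => M * θ ^ (k + 1)) Filter.atTop (nhds (M * 0)) :=
    ENNReal.Tendsto.const_mul ((Filter.tendsto_add_atTop_iff_nat 1).2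
      (ENNReal.tendsto_pow_atTop_nhds_zero_of_lt_one hθ1)) (Or.inr ENNReal.coe_ne_top)
  rw [mul_zero] at hlim
  exact tendsto_of_tendsto_of_tendsto_of_le_of_le tendsto_const_nhds hlim (fun _ => zero_le) hpend

/-- Finiteness of the smaller risk permits cancelling the errors, and positivity of both weights
turns a strict gain in either error into a strict loss in cost. An infinite K' is harmless because K
is finite. -/
theorem le_and_lt_of_risk_le {K K' α α' β β' : ℝ≥0∞} (hl₀ : 0 < l₀) (hl₁ : 0 < l₁)
    (hfin : K + (l₀ * α + l₁ * β) ≠ ∞)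
    (h : K + (l₀ * α + l₁ * β) ≤ K' + (l₀ * α' + l₁ * β')) (hα : α' ≤ α) (hβ : β' ≤ β) :
    K ≤ K' ∧ (α' < α ∨ β' < β → K < K') := by
  have hle : (l₀ * α' + l₁ * β' : ℝ≥0∞) ≤ l₀ * α + l₁ * β := by gcongr
  obtain ⟨hK, hE⟩ := ENNReal.add_ne_top.1 hfin
  obtain ⟨hE₀, hE₁⟩ := ENNReal.add_ne_top.1 hE
  refine ⟨(ENNReal.add_le_add_iff_right hE).1 (h.trans (by gcongr)), fun hlt => ?_⟩
  have hEE : (l₀ * α' + l₁ * β' : ℝ≥0∞) < l₀ * α + l₁ * β := by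
    rcases hlt with hlt | hlt
    · refine ENNReal.add_lt_add_of_lt_of_le
        (ne_top_of_le_ne_top hE₁ (by gcongr)) ?_ (by gcongr)
      exact (ENNReal.mul_lt_mul_iff_right (by simpa using hl₀.ne') ENNReal.coe_ne_top).2 hlt
    · refine ENNReal.add_lt_add_of_le_of_lt
        (ne_top_of_le_ne_top hE₀ (by gcongr)) (by gcongr) ?_
      exact (ENNReal.mul_lt_mul_iff_right (by simpa using hl₁.ne') ENNReal.coe_ne_top).2 hlt
  rcases eq_or_ne K' ∞ with rfl | hK'
  · exact hK.lt_top
  · exact (ENNReal.add_lt_add_iff_right hE).1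
      (h.trans_lt ((ENNReal.add_lt_add_iff_left hK').2 hEE))

end GroupSequential

/-! ### Assembly of the theorem. -/

namespace GroupSequential

variable {𝔛 : Type*} {𝒢 : Set ℕ} [MeasurableSpace 𝔛]

/-- A pair of rules that stops outside `[A, B]`, continues inside `(A, B)` and rejects `H₀` when the
likelihood ratio is at least `B` minimizes, over the terminating tests, a weighted sum of its
expected sample costs and its error probabilities with positive weights of the errors. -/
theorem exists_weights_risk_le {μ : Measure 𝔛} [SigmaFinite μ] {f : Fin 2 → 𝔛 → ℝ≥0} {p : PMF 𝒢}
    (hf : ∀ i, Measurable (f i)) (hf_one : ∀ i, ∫⁻ x, (f i x : ℝ≥0∞) ∂μ = 1)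
    (hκ : IsLikelihoodStep (stepMeasure μ f p)) {A B : ℝ≥0} (hA : 0 < A) (hAB : A < B)
    (ψ φ : RandomizedRule 𝔛 𝒢)
    (haction : ∀ (k : ℕ) (n : Fin (k + 1) → 𝒢) (x : Sample 𝔛 n), ψ.val k n x ≠ 0 →
      likelihoodRatio f n x ≤ A ∨ B ≤ likelihoodRatio f n x)
    (hcont : ∀ (k : ℕ) (n : Fin (k + 1) → 𝒢) (x : Sample 𝔛 n), 1 - ψ.val k n x ≠ 0 →
      A * (densities f n x).1 ≤ (densities f n x).2 ∧
        (densities f n x).2 ≤ B * (densities f n x).1)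
    (hφ : ∀ (k : ℕ) (n : Fin (k + 1) → 𝒢) (x : Sample 𝔛 n), φ.val k n x =
      (Set.Ici (B : ℝ≥0∞)).indicator 1 (likelihoodRatio f n x))
    (b₀ b₁ : ℝ≥0) (hb : 0 < b₀ + b₁) :
    ∃ l₀ l₁ : ℝ≥0, 0 < l₀ ∧ 0 < l₁ ∧ ∃ v : ℝ≥0∞, v ≠ ∞ ∧
      (b₀ * ∑' k, pending μ f p ψ 0 k + b₁ * ∑' k, pending μ f p ψ 1 k)
        + (l₀ * typeIError μ f p ψ φ + l₁ * typeIIError μ f p ψ φ) ≤ v ∧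
      ∀ ψ' φ' : RandomizedRule 𝔛 𝒢, Terminates μ (f 0) p ψ' → Terminates μ (f 1) p ψ' →
        v ≤ (b₀ * ∑' k, pending μ f p ψ' 0 k + b₁ * ∑' k, pending μ f p ψ' 1 k)
          + (l₀ * typeIError μ f p ψ' φ' + l₁ * typeIIError μ f p ψ' φ') := by
  obtain ⟨l₀, l₁, hl₀, hl₁, R, hR, hR₀, hR₁, hRc, hhigh, hlow, hmid⟩ :=
    exists_value hκ hA hAB b₀ b₁ hb
  refine ⟨l₀, l₁, hl₀, hl₁, continuationCost μ f p b₀ b₁ R 1, ?_, ?_, ?_⟩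
  · have h : transition (stepMeasure μ f p) R 1 ≤ l₀ * ((1 : ℝ≥0 × ℝ≥0).1 : ℝ≥0) := by
      rw [← transition_fst hκ, ← transition_const_mul]
      exact transition_mono hR₀ 1
    exact ENNReal.add_ne_top.2 ⟨by simp, ne_top_of_le_ne_top (by simp) h⟩
  · refine risk_le_continuationCost hf hR ψ φ (fun k n x => ?_) (fun k n x => ?_)
    · by_cases h0 : ψ.val k n x = 0
      · simp [h0]
      gcongr
      rw [hφ]
      by_cases hB : (B : ℝ≥0∞) ≤ likelihoodRatio f n x
      · simpa [hB] using hhigh _ (mul_fst_le_snd_of_le_likelihoodRatio hB)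
      · simpa [hB] using hlow _
          (snd_le_mul_fst_of_likelihoodRatio_le ((haction k n x h0).resolve_right hB))
    · by_cases h0 : 1 - ψ.val k n x = 0
      · simp [h0]
      gcongr
      exact hmid _ (hcont k n x h0).1 (hcont k n x h0).2
  · exact fun ψ' φ' h₀ h₁ => continuationCost_le_risk hf hf_one hR hR₀ hR₁ hRc ψ' φ' h₀ h₁

end GroupSequential

theorem mainTheorem1 {𝔛 : Type*} [MeasurableSpace 𝔛] (μ : Measure 𝔛) [SigmaFinite μ]
    (f : Fin 2 → 𝔛 → ℝ≥0) (hf_meas : ∀ i, Measurable (f i))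
    (hf_one : ∀ i, ∫⁻ x, (f i x : ℝ≥0∞) ∂μ = 1)
    (hf_ne : 0 < μ {x | f 0 x ≠ f 1 x})
    (𝒢 : Set ℕ) (p : PMF 𝒢) (hp : ∃ m : 𝒢, 0 < (m : ℕ) ∧ 0 < p m)
    (c : 𝒢 → ℝ≥0) (hc_pos : ∀ m, 0 < c m) (hc_fin : ∑' m, p m * (c m : ℝ≥0∞) < ∞)
    (A B : ℝ≥0) (hA : 0 < A) (hAB : A < B)
    (ψ φ : GroupSequential.RandomizedRule 𝔛 𝒢)
    (hψ : ∀ (k : ℕ) (n : Fin (k + 1) → 𝒢) (x : GroupSequential.Sample 𝔛 n),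
      (Set.Ioo (A : ℝ≥0∞) (B : ℝ≥0∞)).indicator 1 (GroupSequential.likelihoodRatio f n x)
          ≤ 1 - ψ.val k n x ∧
        1 - ψ.val k n x ≤
          (Set.Icc (A : ℝ≥0∞) (B : ℝ≥0∞)).indicator 1 (GroupSequential.likelihoodRatio f n x))
    (hφ : ∀ (k : ℕ) (n : Fin (k + 1) → 𝒢) (x : GroupSequential.Sample 𝔛 n),
      φ.val k n x =
        (Set.Ici (B : ℝ≥0∞)).indicator 1 (GroupSequential.likelihoodRatio f n x)) :
    (ψ, φ) ∈ GroupSequential.testClass μ f p 0 ∩ GroupSequential.testClass μ f p 1 ∧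
    ∀ ψ' φ' : GroupSequential.RandomizedRule 𝔛 𝒢,
      (ψ', φ') ∈ GroupSequential.testClass μ f p 0 ∩ GroupSequential.testClass μ f p 1 →
      GroupSequential.typeIError μ f p ψ' φ' ≤ GroupSequential.typeIError μ f p ψ φ →
      GroupSequential.typeIIError μ f p ψ' φ' ≤ GroupSequential.typeIIError μ f p ψ φ →
      (GroupSequential.averageCost μ f p c 0 ψ ≤ GroupSequential.averageCost μ f p c 0 ψ' ∧
        GroupSequential.averageCost μ f p c 1 ψ ≤ GroupSequential.averageCost μ f p c 1 ψ') ∧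
      (GroupSequential.typeIError μ f p ψ' φ' < GroupSequential.typeIError μ f p ψ φ ∨
          GroupSequential.typeIIError μ f p ψ' φ' < GroupSequential.typeIIError μ f p ψ φ →
        GroupSequential.averageCost μ f p c 0 ψ < GroupSequential.averageCost μ f p c 0 ψ' ∧
          GroupSequential.averageCost μ f p c 1 ψ < GroupSequential.averageCost μ f p c 1 ψ') := by
  have hκ := GroupSequential.isLikelihoodStep_stepMeasure hf_meas hf_one hf_ne hp
  have haction : ∀ (k : ℕ) (n : Fin (k + 1) → 𝒢) (x : GroupSequential.Sample 𝔛 n),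
      ψ.val k n x ≠ 0 → GroupSequential.likelihoodRatio f n x ≤ A ∨
        B ≤ GroupSequential.likelihoodRatio f n x := by
    intro k n x h0
    by_contra! h
    have h1 := (hψ k n x).1
    rw [Set.indicator_of_mem (Set.mem_Ioo.2 h), Pi.one_apply] at h1
    refine h0 ?_
    have h2 : ψ.val k n x = 1 - (1 - ψ.val k n x) :=
      (ENNReal.sub_sub_cancel ENNReal.one_ne_top (ψ.le_one k n x)).symm
    rw [h2]
    exact tsub_eq_zero_of_le h1
  have hcont : ∀ (k : ℕ) (n : Fin (k + 1) → 𝒢) (x : GroupSequential.Sample 𝔛 n),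
      1 - ψ.val k n x ≠ 0 →
      A * (GroupSequential.densities f n x).1 ≤ (GroupSequential.densities f n x).2 ∧
        (GroupSequential.densities f n x).2 ≤ B * (GroupSequential.densities f n x).1 := by
    intro k n x h0
    have h : GroupSequential.likelihoodRatio f n x ∈ Set.Icc (A : ℝ≥0∞) B := by
      by_contra h
      have h1 := (hψ k n x).2
      rw [Set.indicator_of_notMem h] at h1
      exact h0 (le_antisymm h1 zero_le)
    exact ⟨GroupSequential.mul_fst_le_snd_of_le_likelihoodRatio h.1,
      GroupSequential.snd_le_mul_fst_of_likelihoodRatio_le h.2⟩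
  have hterm := GroupSequential.terminates_of_continue_le hf_meas hf_one hκ hA ψ hcont
  refine ⟨⟨hterm 0, hterm 1⟩, fun ψ' φ' hψ' hα hβ => ?_⟩
  obtain ⟨b, hb⟩ : ∃ b : ℝ≥0, ∑' m, p m * (c m : ℝ≥0∞) = b :=
    ⟨_, (ENNReal.coe_toNNReal hc_fin.ne).symm⟩
  have hb0 : 0 < b := by
    obtain ⟨m, -, hm⟩ := hp
    have h1 : 0 < p m * (c m : ℝ≥0∞) :=
      ENNReal.mul_pos hm.ne' (by simpa using (hc_pos m).ne')
    have h2 := h1.trans_le (ENNReal.le_tsum (f := fun m => p m * (c m : ℝ≥0∞)) m)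
    rw [hb] at h2
    exact_mod_cast h2
  have hupper := fun i => GroupSequential.averageCost_le (p := p) ψ hf_meas hf_one c i
  have hlower₀ := GroupSequential.le_averageCost ψ' hf_meas hf_one c 0 hψ'.1
  have hlower₁ := GroupSequential.le_averageCost ψ' hf_meas hf_one c 1 hψ'.2
  simp only [hb] at hupper hlower₀ hlower₁
  have hweights := GroupSequential.exists_weights_risk_le hf_meas hf_one hκ hA hAB ψ φ
    haction hcont hφ
  have h₀ : GroupSequential.averageCost μ f p c 0 ψ ≤ GroupSequential.averageCost μ f p c 0 ψ' ∧
      (GroupSequential.typeIError μ f p ψ' φ' < GroupSequential.typeIError μ f p ψ φ ∨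
          GroupSequential.typeIIError μ f p ψ' φ' < GroupSequential.typeIIError μ f p ψ φ →
        GroupSequential.averageCost μ f p c 0 ψ < GroupSequential.averageCost μ f p c 0 ψ') := by
    -- Observations are charged under H₀ only, at the mean group cost `b`, so that the running part
    -- of the risk is exactly the Wald expression for K₀.
    obtain ⟨l₀, l₁, hl₀, hl₁, v, hv, hle, hge⟩ := hweights b 0 (by simpa using hb0)
    have hge' := hge ψ' φ' hψ'.1 hψ'.2
    simp only [ENNReal.coe_zero, zero_mul, add_zero] at hle hge'
    have hle' := (add_le_add (hupper 0) le_rfl).trans hle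
    exact GroupSequential.le_and_lt_of_risk_le hl₀ hl₁ (ne_top_of_le_ne_top hv hle')
      (hle'.trans (hge'.trans (add_le_add hlower₀ le_rfl))) hα hβ
  have h₁ : GroupSequential.averageCost μ f p c 1 ψ ≤ GroupSequential.averageCost μ f p c 1 ψ' ∧
      (GroupSequential.typeIError μ f p ψ' φ' < GroupSequential.typeIError μ f p ψ φ ∨
          GroupSequential.typeIIError μ f p ψ' φ' < GroupSequential.typeIIError μ f p ψ φ →
        GroupSequential.averageCost μ f p c 1 ψ < GroupSequential.averageCost μ f p c 1 ψ') := by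
    obtain ⟨l₀, l₁, hl₀, hl₁, v, hv, hle, hge⟩ := hweights 0 b (by simpa using hb0)
    have hge' := hge ψ' φ' hψ'.1 hψ'.2
    simp only [ENNReal.coe_zero, zero_mul, zero_add] at hle hge'
    have hle' := (add_le_add (hupper 1) le_rfl).trans hle
    exact GroupSequential.le_and_lt_of_risk_le hl₀ hl₁ (ne_top_of_le_ne_top hv hle')
      (hle'.trans (hge'.trans (add_le_add hlower₁ le_rfl))) hα hβ
  exact ⟨⟨h₀.1, h₁.1⟩, fun h => ⟨h₀.2 h, h₁.2 h⟩⟩
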